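/- For a set $I$ let $\ell_2(I)$ be the complex Hilbert space of square-summable families with its standard orthonormal basis $\{e_i\}_{i\in I}$, and write $f(i)$ for the $i$-th coordinate of $f$. For $E\subseteq I$ let $\ell_2(E)\subseteq \ell_2(I)$ be the subspace of vectors supported in $E$ and $P_E$ the orthogonal projection of $\ell_2(I)$ onto it. A subspace $\mathbb H$ of $\ell_2(I)$ is *$A$-large* ($A>0$) if it is closed and for each $i\in I$ there is $f_i\in\mathbb H$ with $\|f_i\|=1$ and $|f_i(i)|\ge A$; it is *large* if it is $A$-large for some $A>0$. A closed subspace $\mathbb H$ is *$r$-decomposable* if there is a partition $\{E_j\}_{j=1}^r$ of $I$ (empty parts allowed) with $P_{E_j}(\mathbb H)=\ell_2(E_j)$ for all $j=1,\dots,r$; it is *finitely decomposable* if it is $r$-decomposable for some natural number $r$. Theorem. Let $I$ be an infinite set. The following are equivalent: (1) (Positive answer to the Kadison–Singer Problem.) Every pure state on the algebra $\mathbb D$ of bounded diagonal operators on $\ell_2=\ell_2(\mathbb N)$ has a unique extension to a state on $B(\ell_2)$. Here a state is a linear functional $\varphi$ with $\varphi(\mathrm{Id})=1$ and $\varphi(T)\ge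 0$ whenever $T\ge 0$, and a pure state is an extreme point of the convex set of states. (2) Every large subspace of $\ell_2(I)$ is finitely decomposable. (3) For every $0<A<1$ there is a natural number $r=r(A)$ such that every $A$-large subspace of $\ell_2(I)$ is $r$-decomposable. The three statements are also equivalent if in (2) and (3) the index set $I$ is not fixed but ranges over all sets, finite or infinite, with $r$ in (3) depending only on $A$ and not on $I$. -/

import Mathlib

open scoped ComplexOrder InnerProductSpace

universe u

/-- The Hilbert space `ℓ₂(I)` of square-summable complex families; `f i` is the `i`-th coordinate. -/
abbrev Ell2 (I : Type*) : Type _ := lp (fun _ : I => ℂ) 2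

/-- The bounded linear operators on `ℓ₂(I)`, with the operator (Loewner) order. -/
abbrev BEll2 (I : Type*) : Type _ := Ell2 I →L[ℂ] Ell2 I

/-- The algebra of bounded diagonal operators on `ℓ₂(I)`:
the operators that multiply the `i`-th coordinate by a scalar `d i`. -/
noncomputable def diagonalOperators (I : Type*) : StarSubalgebra ℂ (BEll2 I) where
  carrier := {T | ∃ d : I → ℂ, ∀ (f : Ell2 I) (i : I), T f i = d i * f i}
  mul_mem' := by
    rintro S T ⟨d, hd⟩ ⟨e, he⟩
    refine ⟨fun i => d i * e i, fun f i => ?_⟩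
    rw [mul_apply_eq_comp, hd, he, mul_assoc]
  add_mem' := by
    rintro S T ⟨d, hd⟩ ⟨e, he⟩
    refine ⟨fun i => d i + e i, fun f i => ?_⟩
    rw [add_apply, lp.coeFn_add, Pi.add_apply, hd, he, add_mul]
  algebraMap_mem' c := by
    refine ⟨fun _ => c, fun f i => ?_⟩
    rw [Algebra.algebraMap_eq_smul_one]
    simp
  star_mem' := by
    classical
    rintro T ⟨d, hd⟩
    refine ⟨fun i => star (d i), fun f i => ?_⟩
    have key : ∀ g : Ell2 I, ⟪lp.single 2 i (1 : ℂ), g⟫_ℂ = g i := fun g => by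
      rw [lp.inner_single_left]; simp
    have hT : T (lp.single 2 i (1 : ℂ)) = d i • lp.single 2 i (1 : ℂ) := by
      ext j
      rw [hd, lp.coeFn_smul, Pi.smul_apply, smul_eq_mul]
      by_cases h : j = i
      · subst h; rfl
      · rw [lp.single_apply_ne 2 i _ h]; simp
    rw [← key, ContinuousLinearMap.star_eq_adjoint, ContinuousLinearMap.adjoint_inner_right, hT,
      inner_smul_left, key]
    rfl

/-- The states of an ordered complex algebra `R`: the linear functionals `φ` on `R`
with `φ 1 = 1` and `φ T ≥ 0` for every `T ≥ 0`. -/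
def states (R : Type*) [Ring R] [Algebra ℂ R] [PartialOrder R] : Set (R →ₗ[ℂ] ℂ) :=
  {φ | φ 1 = 1 ∧ ∀ T : R, 0 ≤ T → 0 ≤ φ T}

/-- The pure states are the extreme points of the convex set of states. -/
def pureStates (R : Type*) [Ring R] [Algebra ℂ R] [PartialOrder R] : Set (R →ₗ[ℂ] ℂ) :=
  (states R).extremePoints ℝ

/-- The (positive answer to the) Kadison–Singer Problem: every pure state on the algebra of
bounded diagonal operators on `ℓ₂` has a unique extension to a state on `B(ℓ₂)`. -/
def KadisonSinger : Prop :=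
  ∀ φ ∈ pureStates (diagonalOperators ℕ),
    ∃! ψ : BEll2 ℕ →ₗ[ℂ] ℂ,
      ψ ∈ states (BEll2 ℕ) ∧ ∀ T : diagonalOperators ℕ, ψ (T : BEll2 ℕ) = φ T

/-- The subspace `ℓ₂(E)` of `ℓ₂(I)`, for `E ⊆ I`: the vectors supported in `E`. -/
def coordSubspace {I : Type*} (E : Set I) : Submodule ℂ (Ell2 I) where
  carrier := {f | ∀ i, i ∉ E → f i = 0}
  zero_mem' := fun _ _ => rfl
  add_mem' := by
    intro f g hf hg i hi
    rw [lp.coeFn_add, Pi.add_apply, hf i hi, hg i hi, add_zero]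
  smul_mem' := by
    intro c f hf i hi
    rw [lp.coeFn_smul, Pi.smul_apply, hf i hi, smul_zero]

theorem isClosed_coordSubspace {I : Type*} (E : Set I) :
    IsClosed (coordSubspace E : Set (Ell2 I)) := by
  have h : (coordSubspace E : Set (Ell2 I)) = ⋂ i, ⋂ _ : i ∉ E, {f : Ell2 I | f i = 0} := by
    ext f
    simp only [Set.mem_iInter, Set.mem_ofPred_eq]
    rfl
  rw [h]
  refine isClosed_iInter fun i => isClosed_iInter fun _ => ?_
  have hc : Continuous fun f : Ell2 I => f i :=
    (continuous_apply i).comp (lp.uniformContinuous_coe (E := fun _ : I => ℂ) (p := 2)).continuous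
  exact isClosed_eq hc continuous_const

instance {I : Type*} (E : Set I) : CompleteSpace (coordSubspace E) :=
  (isClosed_coordSubspace E).completeSpace_coe

/-- The orthogonal projection `P_E` of `ℓ₂(I)` onto `ℓ₂(E)`. -/
noncomputable def coordProj {I : Type*} (E : Set I) : BEll2 I :=
  (coordSubspace E).starProjection

/-- `H` is `A`-large: `A > 0`, `H` is closed, and for every `i` some unit vector `f ∈ H`
has `|f i| ≥ A`. -/
def IsALarge {I : Type*} (A : ℝ) (H : Submodule ℂ (Ell2 I)) : Prop :=
  0 < A ∧ IsClosed (H : Set (Ell2 I)) ∧ ∀ i : I, ∃ f ∈ H, ‖f‖ = 1 ∧ A ≤ ‖f i‖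

/-- `H` is large if it is `A`-large for some `A > 0`. -/
def IsLarge {I : Type*} (H : Submodule ℂ (Ell2 I)) : Prop :=
  ∃ A : ℝ, IsALarge A H

/-- `H` is `r`-decomposable: `H` is closed and `I` is a disjoint union of `r` sets `E j`
(possibly empty) with `P_{E j} H = ℓ₂(E j)` for every `j`. -/
def IsRDecomposable {I : Type*} (r : ℕ) (H : Submodule ℂ (Ell2 I)) : Prop :=
  IsClosed (H : Set (Ell2 I)) ∧
    ∃ E : Fin r → Set I, Pairwise (fun j k => Disjoint (E j) (E k)) ∧ (⋃ j, E j) = Set.univ ∧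
      ∀ j, H.map (coordProj (E j)).toLinearMap = coordSubspace (E j)

/-- `H` is finitely decomposable if it is `r`-decomposable for some `r`. -/
def IsFinitelyDecomposable {I : Type*} (H : Submodule ℂ (Ell2 I)) : Prop :=
  ∃ r : ℕ, IsRDecomposable r H

/-! Pure states of the diagonal algebra are limits of `⟪e_i, T e_i⟫` along ultrafilters `U`. (1) to
(3). The projection `Q` onto an `A`-large subspace has diagonal at least `A ^ 2`; take `c < A ^ 2`.
On `ℕ`, if `Q ≥ c` failed on `ℓ₂(E)` for every `E ∈ U`, the bad unit vectors would produce a state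
with value at most `c` at `Q`, extending the same pure state as the limit of the basis vector
states, whose value is at least `A ^ 2`. So uniqueness gives a good set in every ultrafilter, and by
compactness finitely many good sets cover `ℕ` (`KadisonSinger.exists_coloring`). If no number of
colors served all index sets, finite pieces of the counterexamples, placed in one direct sum over a
countable set, would contradict this (`KadisonSinger.exists_uniform_coloring`). For `c > 0`, a lower
bound on `ℓ₂(E)` makes the compression of `Q` invertible, hence `P_E H = ℓ₂(E)`. (2) to (1). For a
self-adjoint `T` with zero diagonal and `-1 ≤ T ≤ 1`, the vectors `(√((1+T)/2) x, √((1-T)/2) x)`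
form a large subspace. Decomposing a direct sum of such subspaces bounds a whole sequence of
operators `T` away from `-1` on pieces of finite partitions, with one constant
(`exists_uniform_boundedBelowOn`). A state concentrated on `U` sees only the piece lying in `U`, so
compressing and rescaling contradicts a positive supremum of its values on such `T`
(`states_re_nonpos`). It therefore vanishes on operators with zero diagonal and is determined by its
diagonal restriction. -/

/-! ### Coordinate restriction, extension by zero and coordinate projections. -/

section Coordinates

variable {I J : Type*}

open Classical in
/-- The standard basis vector `e_i` of `ℓ₂(I)`. -/
noncomputable def stdVec (i : I) : Ell2 I := lp.single 2 i 1

theorem inner_stdVec_left (i : I) (f : Ell2 I) : ⟪stdVec i, f⟫_ℂ = f i := by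
  classical
  rw [stdVec, lp.inner_single_left]; simp

theorem stdVec_apply_self (i : I) : stdVec i i = 1 := by
  classical
  exact lp.single_apply_self 2 i _

theorem stdVec_apply_ne {i j : I} (h : j ≠ i) : stdVec i j = 0 := by
  classical
  exact lp.single_apply_ne 2 i _ h

theorem norm_stdVec (i : I) : ‖stdVec i‖ = 1 := by
  classical
  rw [stdVec, lp.norm_single (by norm_num)]; simp

theorem coordSubspace_mono {E F : Set I} (h : E ⊆ F) :
    coordSubspace E ≤ coordSubspace F :=
  fun _ hf i hi => hf i fun hE => hi (h hE)

theorem summable_norm_sq (f : Ell2 I) : Summable fun i => ‖f i‖ ^ 2 := by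
  have := (lp.memℓp f).summable (by norm_num)
  simpa using this

theorem norm_sq_eq_tsum (f : Ell2 I) : ‖f‖ ^ 2 = ∑' i, ‖f i‖ ^ 2 := by
  have := lp.norm_rpow_eq_tsum (p := 2) (by norm_num) f
  simpa using this

theorem memℓp_two_of_summable {g : I → ℂ} (h : Summable fun i => ‖g i‖ ^ 2) : Memℓp g 2 :=
  memℓp_gen (by simpa using h)

/-- Restriction of families along an embedding of index sets. -/
noncomputable def restrictL (e : J ↪ I) : Ell2 I →L[ℂ] Ell2 J :=
  LinearMap.mkContinuous
    { toFun := fun f => ⟨fun j => f (e j),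
        memℓp_two_of_summable ((summable_norm_sq f).comp_injective e.injective)⟩
      map_add' := fun _ _ => rfl
      map_smul' := fun _ _ => rfl } 1 fun f => by
    rw [one_mul]
    refine le_of_sq_le_sq ?_ (norm_nonneg _)
    rw [norm_sq_eq_tsum, norm_sq_eq_tsum f]
    exact ((summable_norm_sq f).comp_injective e.injective).tsum_le_tsum_of_inj e e.injective
      (fun _ _ => by positivity) (fun _ => le_rfl) (summable_norm_sq f)

@[simp]
theorem restrictL_apply (e : J ↪ I) (f : Ell2 I) (j : J) : restrictL e f j = f (e j) := rfl

/-- Extension of families by zero along an embedding of index sets. -/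
noncomputable def extendL (e : J ↪ I) : Ell2 J →L[ℂ] Ell2 I :=
  ContinuousLinearMap.adjoint (restrictL e)

theorem inner_extendL_left (e : J ↪ I) (u : Ell2 J) (f : Ell2 I) :
    ⟪extendL e u, f⟫_ℂ = ⟪u, restrictL e f⟫_ℂ :=
  ContinuousLinearMap.adjoint_inner_left _ _ _

theorem inner_extendL_right (e : J ↪ I) (u : Ell2 J) (f : Ell2 I) :
    ⟪f, extendL e u⟫_ℂ = ⟪restrictL e f, u⟫_ℂ :=
  ContinuousLinearMap.adjoint_inner_right _ _ _

theorem restrictL_stdVec (e : J ↪ I) (j : J) : restrictL e (stdVec (e j)) = stdVec j := by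
  ext k
  rw [restrictL_apply]
  by_cases h : k = j
  · rw [h, stdVec_apply_self, stdVec_apply_self]
  · rw [stdVec_apply_ne h, stdVec_apply_ne (fun h' => h (e.injective h'))]

theorem restrictL_stdVec_of_notMem (e : J ↪ I) {i : I} (hi : i ∉ Set.range e) :
    restrictL e (stdVec i) = 0 := by
  ext k
  rw [restrictL_apply, stdVec_apply_ne fun h => hi ⟨k, h⟩]
  rfl

@[simp]
theorem extendL_apply (e : J ↪ I) (u : Ell2 J) (j : J) : extendL e u (e j) = u j := by
  rw [← inner_stdVec_left, inner_extendL_right, restrictL_stdVec, inner_stdVec_left]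

theorem extendL_apply_of_notMem (e : J ↪ I) (u : Ell2 J) {i : I} (hi : i ∉ Set.range e) :
    extendL e u i = 0 := by
  rw [← inner_stdVec_left, inner_extendL_right, restrictL_stdVec_of_notMem e hi, inner_zero_left]

@[simp]
theorem restrictL_extendL (e : J ↪ I) (u : Ell2 J) : restrictL e (extendL e u) = u := by
  ext j
  simp

theorem norm_extendL (e : J ↪ I) (u : Ell2 J) : ‖extendL e u‖ = ‖u‖ := by
  rw [@norm_eq_sqrt_re_inner ℂ, @norm_eq_sqrt_re_inner ℂ _ _ _ _ u, inner_extendL_left,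
    restrictL_extendL]

theorem norm_restrictL_le (e : J ↪ I) (f : Ell2 I) : ‖restrictL e f‖ ≤ ‖f‖ := by
  have h := LinearMap.mkContinuous_norm_le
    { toFun := fun f : Ell2 I => (⟨fun j => f (e j),
        memℓp_two_of_summable ((summable_norm_sq f).comp_injective e.injective)⟩ : Ell2 J)
      map_add' := fun _ _ => rfl
      map_smul' := fun _ _ => rfl : Ell2 I →ₗ[ℂ] Ell2 J} zero_le_one
  exact ((restrictL e).le_of_opNorm_le (h _) f).trans_eq (one_mul _)

theorem extendL_stdVec (e : J ↪ I) (j : J) : extendL e (stdVec j) = stdVec (e j) := by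
  ext i
  by_cases hi : i ∈ Set.range e
  · obtain ⟨k, rfl⟩ := hi
    rw [extendL_apply, ← restrictL_apply, restrictL_stdVec]
  · rw [extendL_apply_of_notMem e _ hi, stdVec_apply_ne fun h => hi ⟨j, h.symm⟩]

theorem extendL_mem_coordSubspace (e : J ↪ I) {E : Set I} {u : Ell2 J}
    (hu : u ∈ coordSubspace (e ⁻¹' E)) : extendL e u ∈ coordSubspace E := by
  intro i hi
  by_cases h : i ∈ Set.range e
  · obtain ⟨k, rfl⟩ := h
    rw [extendL_apply]
    exact hu k hi
  · exact extendL_apply_of_notMem e _ h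

theorem extendL_restrictL (e : J ↪ I) {f : Ell2 I} (hf : f ∈ coordSubspace (Set.range e)) :
    extendL e (restrictL e f) = f := by
  ext i
  by_cases h : i ∈ Set.range e
  · obtain ⟨k, rfl⟩ := h
    rw [extendL_apply, restrictL_apply]
  · rw [extendL_apply_of_notMem e _ h, hf i h]

/-- The inclusion of a subset, as an embedding. -/
abbrev inclEmb (E : Set I) : E ↪ I := Function.Embedding.subtype (· ∈ E)

theorem range_inclEmb (E : Set I) : Set.range (inclEmb E) = E := Subtype.range_coe

theorem coordProj_eq (E : Set I) (f : Ell2 I) :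
    coordProj E f = extendL (inclEmb E) (restrictL (inclEmb E) f) := by
  refine Submodule.eq_starProjection_of_mem_orthogonal ?_ ?_
  · exact fun i hi => extendL_apply_of_notMem _ _ (by rwa [range_inclEmb])
  · rw [Submodule.mem_orthogonal']
    intro g hg
    have hg' : extendL (inclEmb E) (restrictL (inclEmb E) g) = g :=
      extendL_restrictL _ (by rwa [range_inclEmb])
    rw [inner_sub_left, inner_extendL_left, sub_eq_zero]
    conv_lhs => rw [← hg']
    rw [inner_extendL_right]

theorem coordProj_apply_of_mem {E : Set I} (f : Ell2 I) {i : I} (hi : i ∈ E) :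
    coordProj E f i = f i := by
  rw [coordProj_eq]
  exact extendL_apply (inclEmb E) _ ⟨i, hi⟩

theorem coordProj_mem (E : Set I) (f : Ell2 I) : coordProj E f ∈ coordSubspace E :=
  Submodule.starProjection_apply_mem _ _

theorem coordProj_eq_iff {E : Set I} {f g : Ell2 I} (hg : g ∈ coordSubspace E) :
    coordProj E f = g ↔ ∀ i ∈ E, f i = g i := by
  constructor
  · rintro rfl i hi
    rw [coordProj_apply_of_mem f hi]
  · intro h
    ext i
    by_cases hi : i ∈ E
    · rw [coordProj_apply_of_mem f hi, h i hi]
    · rw [coordProj_mem E f i hi, hg i hi]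

theorem coordProj_of_mem {E : Set I} {f : Ell2 I} (hf : f ∈ coordSubspace E) :
    coordProj E f = f :=
  (coordProj_eq_iff hf).2 fun _ _ => rfl

theorem map_coordProj_eq_iff {E : Set I} {H : Submodule ℂ (Ell2 I)} :
    H.map (coordProj E).toLinearMap = coordSubspace E ↔
      ∀ g ∈ coordSubspace E, ∃ h ∈ H, ∀ i ∈ E, h i = g i := by
  constructor
  · intro h g hg
    rw [← h] at hg
    obtain ⟨x, hx, rfl⟩ := hg
    exact ⟨x, hx, fun i hi => (coordProj_apply_of_mem x hi).symm⟩
  · intro h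
    refine le_antisymm ?_ fun g hg => ?_
    · rintro _ ⟨x, -, rfl⟩
      exact coordProj_mem E x
    · obtain ⟨x, hx, hxg⟩ := h g hg
      exact ⟨x, hx, (coordProj_eq_iff hg).2 hxg⟩

end Coordinates

/-! ### Lower bounds on coordinate subspaces and decomposability. -/

section LowerBounds

variable {I : Type*}

/-- The compression of `Q` to `ℓ₂(E)` is bounded below by `c`. -/
def BoundedBelowOn (Q : BEll2 I) (c : ℝ) (E : Set I) : Prop :=
  ∀ f ∈ coordSubspace E, c * ‖f‖ ^ 2 ≤ (⟪Q f, f⟫_ℂ).re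

theorem BoundedBelowOn.mono {Q : BEll2 I} {c : ℝ} {E F : Set I} (h : BoundedBelowOn Q c F)
    (hEF : E ⊆ F) : BoundedBelowOn Q c E :=
  fun f hf => h f (coordSubspace_mono hEF hf)

/-- Finite truncations of a vector converge to it, and both sides of the inequality are continuous.
-/
theorem boundedBelowOn_of_finset {Q : BEll2 I} {c : ℝ} {E : Set I}
    (h : ∀ S : Finset I, (S : Set I) ⊆ E → BoundedBelowOn Q c S) : BoundedBelowOn Q c E := by
  classical
  intro f hf
  have hsum := lp.hasSum_single (p := 2) (by norm_num) f
  have hc : Continuous fun g : Ell2 I => (⟪Q g, g⟫_ℂ).re - c * ‖g‖ ^ 2 := by fun_prop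
  have hlim := (hc.tendsto f).comp hsum
  rw [← sub_nonneg]
  refine ge_of_tendsto' hlim fun S => ?_
  simp only [Function.comp_apply, sub_nonneg]
  refine h (S.filter (· ∈ E)) (fun i hi => by simp at hi; exact hi.2) _ fun i hi => ?_
  have hi' : ∀ j ∈ S, (lp.single 2 j (f j) : Ell2 I) i = 0 := by
    intro j hj
    by_cases hij : i = j
    · subst hij
      have : i ∉ E := fun hE => hi (by simp [hj, hE])
      rw [hf i this]
      simp
    · exact lp.single_apply_ne 2 j _ hij
  rw [lp.coeFn_sum, Finset.sum_apply]
  exact Finset.sum_eq_zero hi'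

/-- Rado selection: on each finite set the global coloring agrees with the coloring chosen for some
larger finite set, and finite sets suffice to test a lower bound. -/
theorem exists_coloring_of_finset {Q : BEll2 I} {c : ℝ} {r : ℕ}
    (h : ∀ S : Finset I, ∃ χ : I → Fin r, ∀ k, BoundedBelowOn Q c (↑S ∩ χ ⁻¹' {k})) :
    ∃ χ : I → Fin r, ∀ k, BoundedBelowOn Q c (χ ⁻¹' {k}) := by
  choose g hg using h
  obtain ⟨χ, hχ⟩ := Finset.rado_selection g
  refine ⟨χ, fun k => boundedBelowOn_of_finset fun S hS => ?_⟩
  obtain ⟨t, hSt, ht⟩ := hχ S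
  refine (hg t k).mono fun i hi => ⟨hSt hi, ?_⟩
  have h1 := hS hi
  simp only [Set.mem_preimage, Set.mem_singleton_iff] at h1 ⊢
  rw [← ht i hi, h1]

/-- The compression of the projection to `ℓ₂(E)` is coercive, hence invertible. If it sends `u` to
`g`, then projecting `u` into `H` gives a vector that agrees with `g` on `E`. -/
theorem isRDecomposable_of_boundedBelowOn {H : Submodule ℂ (Ell2 I)} [CompleteSpace H]
    {c : ℝ} (hc : 0 < c) {r : ℕ} (χ : I → Fin r)
    (h : ∀ k, BoundedBelowOn H.starProjection c (χ ⁻¹' {k})) : IsRDecomposable r H := by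
  refine ⟨(completeSpace_coe_iff_isComplete.1 ‹_›).isClosed, fun k => χ ⁻¹' {k}, ?_, ?_, ?_⟩
  · intro j k hjk
    rw [Set.disjoint_left]
    rintro i rfl hi
    exact hjk hi
  · ext i
    simp
  · intro k
    set E := χ ⁻¹' {k}
    rw [map_coordProj_eq_iff]
    intro g hg
    set e := inclEmb E
    let S : BEll2 E := restrictL e ∘L H.starProjection ∘L extendL e
    have hS : IsUnit S := by
      refine ContinuousLinearMap.isUnit_of_forall_le_norm_inner_map S (c := ⟨c, hc.le⟩) hc
        fun u => ?_
      have h1 := h k (extendL e u) fun i hi =>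
        extendL_apply_of_notMem _ _ (by rwa [range_inclEmb])
      rw [inner_extendL_right, norm_extendL, mul_comm] at h1
      exact h1.trans (Complex.re_le_norm _)
    rw [ContinuousLinearMap.isUnit_iff_bijective] at hS
    obtain ⟨u, hu⟩ := hS.2 (restrictL e g)
    refine ⟨H.starProjection (extendL e u), Submodule.starProjection_apply_mem _ _,
      fun i hi => ?_⟩
    exact congrArg (fun v : Ell2 E => v ⟨i, hi⟩) hu

/-- The open mapping theorem, applied to the restriction map from `H` onto `ℓ₂(E)`. -/
theorem exists_bounded_lift {H : Submodule ℂ (Ell2 I)} (hH : IsClosed (H : Set (Ell2 I)))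
    {E : Set I} (hE : H.map (coordProj E).toLinearMap = coordSubspace E) :
    ∃ C > 0, ∀ g ∈ coordSubspace E, ∃ h ∈ H, (∀ i ∈ E, h i = g i) ∧ ‖h‖ ≤ C * ‖g‖ := by
  have : CompleteSpace H := hH.completeSpace_coe
  let T : H →L[ℂ] Ell2 E := restrictL (inclEmb E) ∘L H.subtypeL
  have hT : Function.Surjective T := by
    intro u
    obtain ⟨h, hh, hu⟩ := map_coordProj_eq_iff.1 hE (extendL (inclEmb E) u) fun i hi =>
      extendL_apply_of_notMem _ _ (by rwa [range_inclEmb])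
    refine ⟨⟨h, hh⟩, ?_⟩
    ext i
    exact (hu i i.2).trans (extendL_apply (inclEmb E) u i)
  obtain ⟨C, hC, hT⟩ := T.exists_preimage_norm_le hT
  refine ⟨C, hC, fun g hg => ?_⟩
  obtain ⟨h, hh, hle⟩ := hT (restrictL (inclEmb E) g)
  refine ⟨h, h.2, fun i hi => congrArg (fun v : Ell2 E => v ⟨i, hi⟩) hh, hle.trans ?_⟩
  exact mul_le_mul_of_nonneg_left (norm_restrictL_le _ _) hC.le

theorem re_inner_starProjection_self {H : Submodule ℂ (Ell2 I)} [H.HasOrthogonalProjection]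
    (f : Ell2 I) : (⟪H.starProjection f, f⟫_ℂ).re = ‖H.starProjection f‖ ^ 2 := by
  have := Submodule.inner_starProjection_left_eq_right H (H.starProjection f) f
  rw [Submodule.starProjection_eq_self_iff.2 (Submodule.starProjection_apply_mem _ _)] at this
  rw [this]
  exact inner_self_eq_norm_sq (𝕜 := ℂ) _

/-- For a unit vector `f ∈ H`, the coordinate `f i` equals `⟪P e_i, f⟫`, so it is at most `‖P e_i‖`
in modulus. -/
theorem IsALarge.sq_le_re_inner {A : ℝ} {H : Submodule ℂ (Ell2 I)} [H.HasOrthogonalProjection]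
    (h : IsALarge A H) (i : I) :
    A ^ 2 ≤ (⟪H.starProjection (stdVec i), stdVec i⟫_ℂ).re := by
  obtain ⟨f, hf, hf1, hfA⟩ := h.2.2 i
  rw [re_inner_starProjection_self]
  refine pow_le_pow_left₀ h.1.le (hfA.trans ?_) 2
  rw [← inner_stdVec_left, ← Submodule.starProjection_eq_self_iff.2 hf,
    ← Submodule.inner_starProjection_left_eq_right]
  exact (norm_inner_le_norm _ _).trans_eq (by rw [hf1, mul_one])

theorem IsALarge.mono {A B : ℝ} {H : Submodule ℂ (Ell2 I)} (h : IsALarge A H) (hB : 0 < B)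
    (hBA : B ≤ A) : IsALarge B H :=
  ⟨hB, h.2.1, fun i => (h.2.2 i).imp fun _ hf => ⟨hf.1, hf.2.1, hBA.trans hf.2.2⟩⟩

end LowerBounds

/-! ### Transfer of subspaces between index sets, and direct sums. -/

section Constructions

variable {I J : Type*}

theorem isClosed_comap_restrictL (e : J ↪ I) {H : Submodule ℂ (Ell2 J)}
    (hH : IsClosed (H : Set (Ell2 J))) :
    IsClosed (H.comap (restrictL e).toLinearMap : Set (Ell2 I)) :=
  hH.preimage (restrictL e).continuous

/-- The pullback is a copy of `H` plus everything supported off the range of `e`; there `e_i` itself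
is the witness, whence `A ≤ 1`. -/
theorem IsALarge.comap_restrictL (e : J ↪ I) {A : ℝ} {H : Submodule ℂ (Ell2 J)}
    (h : IsALarge A H) (hA : A ≤ 1) : IsALarge A (H.comap (restrictL e).toLinearMap) := by
  refine ⟨h.1, isClosed_comap_restrictL e h.2.1, fun i => ?_⟩
  by_cases hi : i ∈ Set.range e
  · obtain ⟨j, rfl⟩ := hi
    obtain ⟨f, hf, hf1, hfA⟩ := h.2.2 j
    refine ⟨extendL e f, ?_, by rwa [norm_extendL], by rwa [extendL_apply]⟩
    rw [Submodule.mem_comap]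
    simpa using hf
  · refine ⟨stdVec i, ?_, norm_stdVec i, by rw [stdVec_apply_self]; simpa using hA⟩
    rw [Submodule.mem_comap]
    have := restrictL_stdVec_of_notMem e hi
    simp [this]

theorem IsRDecomposable.of_comap_restrictL (e : J ↪ I) {r : ℕ} {H : Submodule ℂ (Ell2 J)}
    (hH : IsClosed (H : Set (Ell2 J)))
    (h : IsRDecomposable r (H.comap (restrictL e).toLinearMap)) : IsRDecomposable r H := by
  obtain ⟨-, E, hdisj, hcover, hE⟩ := h
  refine ⟨hH, fun j => e ⁻¹' E j, fun j k hjk => (hdisj hjk).preimage e, ?_, fun j => ?_⟩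
  · rw [← Set.preimage_iUnion, hcover, Set.preimage_univ]
  · rw [map_coordProj_eq_iff]
    intro g hg
    obtain ⟨f, hf, hfg⟩ := map_coordProj_eq_iff.1 (hE j) _ (extendL_mem_coordSubspace e hg)
    exact ⟨restrictL e f, hf, fun i hi => (hfg (e i) hi).trans (extendL_apply e g i)⟩

variable {R : Type*} {K : R → Type*}

/-- The orthogonal direct sum of subspaces of `ℓ₂(K r)`, inside `ℓ₂` of the disjoint union. -/
noncomputable def directSumSubspace (H : ∀ r, Submodule ℂ (Ell2 (K r))) :
    Submodule ℂ (Ell2 (Σ r, K r)) :=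
  ⨅ r, (H r).comap (restrictL (Function.Embedding.sigmaMk r)).toLinearMap

theorem mem_directSumSubspace {H : ∀ r, Submodule ℂ (Ell2 (K r))} {f : Ell2 (Σ r, K r)} :
    f ∈ directSumSubspace H ↔ ∀ r, restrictL (Function.Embedding.sigmaMk r) f ∈ H r := by
  simp [directSumSubspace]

theorem isClosed_directSumSubspace {H : ∀ r, Submodule ℂ (Ell2 (K r))}
    (hH : ∀ r, IsClosed (H r : Set (Ell2 (K r)))) :
    IsClosed (directSumSubspace H : Set (Ell2 (Σ r, K r))) := by
  rw [directSumSubspace, Submodule.coe_iInf]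
  exact isClosed_iInter fun r => isClosed_comap_restrictL _ (hH r)

theorem restrictL_extendL_sigmaMk_of_ne {r s : R} (h : s ≠ r) (u : Ell2 (K r)) :
    restrictL (Function.Embedding.sigmaMk s) (extendL (Function.Embedding.sigmaMk r) u) = 0 := by
  ext j
  rw [restrictL_apply, extendL_apply_of_notMem]
  · rfl
  · rintro ⟨k, hk⟩
    exact h (congrArg Sigma.fst hk).symm

theorem extendL_mem_directSumSubspace {H : ∀ r, Submodule ℂ (Ell2 (K r))} {r : R}
    {u : Ell2 (K r)} (hu : u ∈ H r) :
    extendL (Function.Embedding.sigmaMk r) u ∈ directSumSubspace H := by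
  rw [mem_directSumSubspace]
  intro s
  by_cases h : s = r
  · subst h
    rwa [restrictL_extendL]
  · rw [restrictL_extendL_sigmaMk_of_ne h]
    exact zero_mem _

theorem isALarge_directSumSubspace {H : ∀ r, Submodule ℂ (Ell2 (K r))} {A : ℝ} (hA : 0 < A)
    (h : ∀ r, IsALarge A (H r)) : IsALarge A (directSumSubspace H) := by
  refine ⟨hA, isClosed_directSumSubspace fun r => (h r).2.1, ?_⟩
  rintro ⟨r, i⟩
  obtain ⟨f, hf, hf1, hfA⟩ := (h r).2.2 i
  refine ⟨_, extendL_mem_directSumSubspace hf, by rwa [norm_extendL], ?_⟩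
  have := extendL_apply (Function.Embedding.sigmaMk r) f i
  rw [Function.Embedding.sigmaMk_apply] at this
  rwa [this]

/-- The projection is block diagonal, so a lower bound for the direct sum passes to each summand. -/
theorem starProjection_directSumSubspace_extendL (H : ∀ r, Submodule ℂ (Ell2 (K r)))
    [∀ r, (H r).HasOrthogonalProjection] [(directSumSubspace H).HasOrthogonalProjection]
    (r : R) (u : Ell2 (K r)) :
    (directSumSubspace H).starProjection (extendL (Function.Embedding.sigmaMk r) u) =
      extendL (Function.Embedding.sigmaMk r) ((H r).starProjection u) := by
  refine Submodule.eq_starProjection_of_mem_orthogonal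
    (extendL_mem_directSumSubspace (Submodule.starProjection_apply_mem _ _)) ?_
  rw [Submodule.mem_orthogonal']
  intro f hf
  rw [← map_sub, inner_extendL_left]
  exact Submodule.inner_left_of_mem_orthogonal (mem_directSumSubspace.1 hf r)
    (Submodule.sub_starProjection_mem_orthogonal _)

end Constructions

section KadisonSinger

open Filter Topology

/-! ### States on ordered star algebras. -/

section GeneralStates

variable {R : Type*} [Ring R] [StarRing R] [Algebra ℂ R] [StarModule ℂ R] [PartialOrder R]

/-- Polarization: `φ` is real on the squares of `a + b` and `a + i b`. Positivity of squares is a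
hypothesis so that the result serves both `B(ℓ₂)` and its diagonal subalgebra. -/
theorem states_conj_symm {φ : R →ₗ[ℂ] ℂ} (hφ : φ ∈ states R) (hR : ∀ a : R, 0 ≤ star a * a)
    (a b : R) : star (φ (star b * a)) = φ (star a * b) := by
  have key : ∀ x : R, (φ (star x * x)).im = 0 := fun x =>
    (Complex.nonneg_iff.1 (hφ.2 _ (hR x))).2.symm
  have h1 := key (a + b)
  have h2 := key (a + Complex.I • b)
  have ha := key a
  have hb := key b
  simp only [star_add, star_smul, add_mul, mul_add, map_add, smul_mul_assoc, mul_smul_comm,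
    map_smul, smul_eq_mul, Complex.add_im, Complex.mul_im, Complex.mul_re, Complex.star_def,
    Complex.conj_I, Complex.neg_re, Complex.neg_im, Complex.I_re, Complex.I_im] at h1 h2
  apply Complex.ext
  · simp only [Complex.star_def, Complex.conj_re]
    linarith
  · simp only [Complex.star_def, Complex.conj_im]
    linarith

/-- The Cauchy–Schwarz inequality for states. -/
theorem states_cauchySchwarz {φ : R →ₗ[ℂ] ℂ} (hφ : φ ∈ states R)
    (hR : ∀ a : R, 0 ≤ star a * a) (a b : R) :
    ‖φ (star a * b)‖ ^ 2 ≤ (φ (star a * a)).re * (φ (star b * b)).re := by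
  let core : PreInnerProductSpace.Core ℂ R :=
    { inner := fun x y => φ (star x * y)
      conj_inner_symm := fun x y => states_conj_symm hφ hR x y
      re_inner_nonneg := fun x => (Complex.nonneg_iff.1 (hφ.2 _ (hR x))).1
      add_left := fun x y z => by simp [add_mul]
      smul_left := fun x y r => by simp }
  have h := InnerProductSpace.Core.inner_mul_inner_self_le (𝕜 := ℂ) (c := core) a b
  have hs : ‖φ (star b * a)‖ = ‖φ (star a * b)‖ := by
    rw [← states_conj_symm hφ hR a b, norm_star]
  change ‖φ (star a * b)‖ * ‖φ (star b * a)‖ ≤ _ at h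
  rw [hs, ← sq] at h
  exact h

/-- Cauchy–Schwarz, with `p = star p * p`. -/
theorem states_mul_eq_zero {φ : R →ₗ[ℂ] ℂ} (hφ : φ ∈ states R)
    (hR : ∀ a : R, 0 ≤ star a * a) {p : R} (hp : IsStarProjection p) (h0 : φ p = 0) (a : R) :
    φ (p * a) = 0 ∧ φ (a * p) = 0 := by
  have hpp : star p * p = p := by rw [hp.isSelfAdjoint.star_eq, hp.isIdempotentElem.eq]
  have h1 := states_cauchySchwarz hφ hR p a
  have h2 := states_cauchySchwarz hφ hR (star a) p
  rw [hpp, h0, Complex.zero_re, zero_mul, hp.isSelfAdjoint.star_eq] at h1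
  rw [hpp, h0, Complex.zero_re, mul_zero, star_star] at h2
  exact ⟨norm_eq_zero.1 (pow_eq_zero_iff two_ne_zero |>.1 (le_antisymm h1 (by positivity))),
    norm_eq_zero.1 (pow_eq_zero_iff two_ne_zero |>.1 (le_antisymm h2 (by positivity)))⟩

theorem states_mul_eq_of_eq_one {φ : R →ₗ[ℂ] ℂ} (hφ : φ ∈ states R)
    (hR : ∀ a : R, 0 ≤ star a * a) {p : R} (hp : IsStarProjection p) (h1 : φ p = 1) (a : R) :
    φ (p * a) = φ a ∧ φ (a * p) = φ a := by
  have h0 : φ (1 - p) = 0 := by rw [map_sub, hφ.1, h1, sub_self]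
  obtain ⟨h2, h3⟩ := states_mul_eq_zero hφ hR hp.one_sub h0 a
  rw [sub_mul, one_mul, map_sub, sub_eq_zero] at h2
  rw [mul_sub, mul_one, map_sub, sub_eq_zero] at h3
  exact ⟨h2.symm, h3.symm⟩

theorem norm_states_le {φ : R →ₗ[ℂ] ℂ} (hφ : φ ∈ states R)
    (hR : ∀ a : R, 0 ≤ star a * a) {a : R} {η : ℝ} (hη : 0 ≤ η)
    (h : 0 ≤ ((η ^ 2 : ℝ) : ℂ) • (1 : R) - star a * a) : ‖φ a‖ ≤ η := by
  have h1 := states_cauchySchwarz hφ hR 1 a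
  rw [star_one, one_mul, one_mul, hφ.1, Complex.one_re, one_mul] at h1
  have h2 := (Complex.nonneg_iff.1 (hφ.2 _ h)).1
  rw [map_sub, map_smul, hφ.1, smul_eq_mul, mul_one, Complex.sub_re, Complex.ofReal_re] at h2
  exact le_of_sq_le_sq (by linarith) hη

end GeneralStates

/-! ### Pure states of the diagonal algebra and ultrafilters. -/

section Ell2States

variable {I : Type*}

theorem star_mul_self_nonneg_BEll2 (T : BEll2 I) : 0 ≤ star T * T :=
  star_mul_self_nonneg T

theorem star_mul_self_nonneg_diagonal (T : diagonalOperators I) : 0 ≤ star T * T :=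
  star_mul_self_nonneg (T : BEll2 I)

theorem nonneg_BEll2_iff {T : BEll2 I} :
    0 ≤ T ↔ IsSelfAdjoint T ∧ ∀ x, 0 ≤ (⟪T x, x⟫_ℂ).re := by
  rw [ContinuousLinearMap.nonneg_iff_isPositive, ContinuousLinearMap.isPositive_def']
  rfl

theorem sq_smul_one_sub_star_mul_self_nonneg {T : BEll2 I} {η : ℝ}
    (h : ∀ x, ‖T x‖ ≤ η * ‖x‖) : 0 ≤ ((η ^ 2 : ℝ) : ℂ) • (1 : BEll2 I) - star T * T := by
  rw [nonneg_BEll2_iff]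
  refine ⟨?_, fun x => ?_⟩
  · rw [isSelfAdjoint_iff, star_sub, star_smul, star_one, star_mul, star_star, Complex.star_def,
      Complex.conj_ofReal]
  · have h1 : ((((η ^ 2 : ℝ) : ℂ) • (1 : BEll2 I) - star T * T) x) =
        ((η ^ 2 : ℝ) : ℂ) • x - ContinuousLinearMap.adjoint T (T x) := rfl
    have h2 : (⟪x, x⟫_ℂ).re = ‖x‖ ^ 2 := inner_self_eq_norm_sq (𝕜 := ℂ) x
    have h3 : (⟪T x, T x⟫_ℂ).re = ‖T x‖ ^ 2 := inner_self_eq_norm_sq (𝕜 := ℂ) (T x)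
    rw [h1, inner_sub_left, inner_smul_left, ContinuousLinearMap.adjoint_inner_left,
      Complex.conj_ofReal, Complex.sub_re, Complex.re_ofReal_mul, h2, h3, sub_nonneg, ← mul_pow]
    exact pow_le_pow_left₀ (norm_nonneg _) (h x) 2

theorem norm_le_of_coord_le {f g : Ell2 I} {η : ℝ} (hη : 0 ≤ η)
    (h : ∀ i, ‖f i‖ ≤ η * ‖g i‖) : ‖f‖ ≤ η * ‖g‖ := by
  refine le_of_sq_le_sq ?_ (by positivity)
  rw [mul_pow, norm_sq_eq_tsum, norm_sq_eq_tsum, ← tsum_mul_left]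
  refine (summable_norm_sq f).tsum_le_tsum (fun i => ?_) ((summable_norm_sq g).mul_left _)
  rw [← mul_pow]
  exact pow_le_pow_left₀ (norm_nonneg _) (h i) 2

/-- The coordinate projections, as diagonal operators. -/
noncomputable def diagonalProj (E : Set I) : diagonalOperators I :=
  ⟨coordProj E, by
    classical
    refine ⟨fun i => if i ∈ E then 1 else 0, fun f i => ?_⟩
    by_cases hi : i ∈ E
    · rw [coordProj_apply_of_mem f hi]
      simp [hi]
    · rw [coordProj_mem E f i hi]
      simp [hi]⟩

theorem coordProj_apply_of_notMem {E : Set I} (f : Ell2 I) {i : I} (hi : i ∉ E) :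
    coordProj E f i = 0 := coordProj_mem E f i hi

theorem isStarProjection_coordProj (E : Set I) : IsStarProjection (coordProj E) :=
  isStarProjection_starProjection

theorem isStarProjection_diagonalProj (E : Set I) : IsStarProjection (diagonalProj E) :=
  ⟨Subtype.ext (isStarProjection_coordProj E).isIdempotentElem,
    Subtype.ext (isStarProjection_coordProj E).isSelfAdjoint⟩

theorem diagonalProj_univ : diagonalProj (Set.univ : Set I) = 1 := by
  refine Subtype.ext (ContinuousLinearMap.ext fun f => ?_)
  ext i
  exact coordProj_apply_of_mem f (Set.mem_univ i)

theorem diagonalProj_mul (E F : Set I) :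
    diagonalProj E * diagonalProj F = diagonalProj (E ∩ F) := by
  refine Subtype.ext (ContinuousLinearMap.ext fun f => ?_)
  ext i
  change coordProj E (coordProj F f) i = coordProj (E ∩ F) f i
  by_cases hE : i ∈ E <;> by_cases hF : i ∈ F
  · rw [coordProj_apply_of_mem _ hE, coordProj_apply_of_mem _ hF,
      coordProj_apply_of_mem _ (Set.mem_inter hE hF)]
  · rw [coordProj_apply_of_mem _ hE, coordProj_apply_of_notMem _ hF,
      coordProj_apply_of_notMem _ fun h => hF h.2]
  · rw [coordProj_apply_of_notMem _ hE, coordProj_apply_of_notMem _ fun h => hE h.1]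
  · rw [coordProj_apply_of_notMem _ hE, coordProj_apply_of_notMem _ fun h => hE h.1]

theorem diagonalProj_compl (E : Set I) : diagonalProj Eᶜ = 1 - diagonalProj E := by
  refine Subtype.ext (ContinuousLinearMap.ext fun f => ?_)
  ext i
  change coordProj Eᶜ f i = f i - coordProj E f i
  by_cases hE : i ∈ E
  · rw [coordProj_apply_of_mem _ hE, coordProj_apply_of_notMem _ (by simpa using hE), sub_self]
  · rw [coordProj_apply_of_notMem _ hE, coordProj_apply_of_mem _ (by simpa using hE), sub_zero]

theorem diagonal_apply {T : BEll2 I} (hT : T ∈ diagonalOperators I) (f : Ell2 I) (i : I) :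
    T f i = ⟪stdVec i, T (stdVec i)⟫_ℂ * f i := by
  obtain ⟨d, hd⟩ := hT
  rw [inner_stdVec_left, hd, hd, stdVec_apply_self, mul_one]

theorem mul_comm_diagonal (S T : diagonalOperators I) : S * T = T * S := by
  refine Subtype.ext (ContinuousLinearMap.ext fun f => ?_)
  ext i
  change (S : BEll2 I) ((T : BEll2 I) f) i = (T : BEll2 I) ((S : BEll2 I) f) i
  rw [diagonal_apply S.2, diagonal_apply T.2, diagonal_apply T.2 (S.1 f), diagonal_apply S.2 f]
  ring

theorem norm_inner_map_self_le {T : BEll2 I} {x : Ell2 I} (hx : ‖x‖ = 1) :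
    ‖⟪x, T x⟫_ℂ‖ ≤ ‖T‖ := by
  refine (norm_inner_le_norm _ _).trans ?_
  rw [hx, one_mul]
  exact (T.le_opNorm x).trans_eq (by rw [hx, mul_one])

theorem exists_tendsto_inner {𝒱 : Ultrafilter (Ell2 I)}
    (h : ∀ᶠ x in (𝒱 : Filter (Ell2 I)), ‖x‖ = 1) (T : BEll2 I) :
    ∃ ℓ : ℂ, Tendsto (fun x => ⟪x, T x⟫_ℂ) 𝒱 (𝓝 ℓ) := by
  have hball : ∀ᶠ x in (𝒱 : Filter (Ell2 I)), ⟪x, T x⟫_ℂ ∈ Metric.closedBall (0 : ℂ) ‖T‖ := by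
    filter_upwards [h] with x hx
    rw [mem_closedBall_zero_iff]
    exact norm_inner_map_self_le hx
  obtain ⟨ℓ, -, hℓ⟩ := (isCompact_closedBall (0 : ℂ) ‖T‖).ultrafilter_le_nhds
    (𝒱.map fun x => ⟪x, T x⟫_ℂ) (le_principal_iff.2 hball)
  exact ⟨ℓ, hℓ⟩

/-- Limits of vector states along an ultrafilter are states. -/
theorem exists_limit_state {𝒱 : Ultrafilter (Ell2 I)}
    (h : ∀ᶠ x in (𝒱 : Filter (Ell2 I)), ‖x‖ = 1) :
    ∃ ψ ∈ states (BEll2 I), ∀ T : BEll2 I, Tendsto (fun x => ⟪x, T x⟫_ℂ) 𝒱 (𝓝 (ψ T)) := by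
  choose ψ hψ using exists_tendsto_inner h
  let Ψ : BEll2 I →ₗ[ℂ] ℂ :=
    { toFun := ψ
      map_add' := fun S T => tendsto_nhds_unique (hψ (S + T)) (by
        simpa [inner_add_right] using (hψ S).add (hψ T))
      map_smul' := fun c T => tendsto_nhds_unique (hψ (c • T)) (by
        simpa [inner_smul_right] using (hψ T).const_mul c) }
  refine ⟨Ψ, ⟨?_, fun T hT => ?_⟩, hψ⟩
  · refine tendsto_nhds_unique (hψ 1) (tendsto_const_nhds.congr' ?_)
    filter_upwards [h] with x hx
    simp [inner_self_eq_norm_sq_to_K, hx]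
  · refine ge_of_tendsto' (hψ T) fun x => ?_
    rw [ContinuousLinearMap.nonneg_iff_isPositive] at hT
    exact hT.inner_nonneg_right x

/-- The state of the diagonal algebra induced by a state on all bounded operators. -/
noncomputable def restrictState (ψ : BEll2 I →ₗ[ℂ] ℂ) : diagonalOperators I →ₗ[ℂ] ℂ :=
  ψ ∘ₗ (diagonalOperators I).toSubalgebra.val.toLinearMap

theorem restrictState_mem {ψ : BEll2 I →ₗ[ℂ] ℂ} (hψ : ψ ∈ states (BEll2 I)) :
    restrictState ψ ∈ states (diagonalOperators I) :=
  ⟨hψ.1, fun T hT => hψ.2 T hT⟩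

/-- A diagonal operator is nearly scalar on the coordinates where its entries are near `ℓ`; this
lets a state concentrated there see only `ℓ`. -/
theorem norm_mul_sub_coordProj_le {T : BEll2 I} (hT : T ∈ diagonalOperators I) {ℓ : ℂ} {η : ℝ}
    (hη : 0 ≤ η) {F : Set I} (hF : ∀ i ∈ F, ‖⟪stdVec i, T (stdVec i)⟫_ℂ - ℓ‖ ≤ η) (x : Ell2 I) :
    ‖(T - ℓ • (1 : BEll2 I)) (coordProj F x)‖ ≤ η * ‖x‖ := by
  refine norm_le_of_coord_le hη fun i => ?_
  have h1 : (T - ℓ • (1 : BEll2 I)) (coordProj F x) i =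
      (⟪stdVec i, T (stdVec i)⟫_ℂ - ℓ) * coordProj F x i := by
    change T (coordProj F x) i - ℓ * coordProj F x i = _
    rw [diagonal_apply hT]
    ring
  rw [h1, norm_mul]
  by_cases hi : i ∈ F
  · rw [coordProj_apply_of_mem x hi]
    exact mul_le_mul_of_nonneg_right (hF i hi) (norm_nonneg _)
  · rw [coordProj_apply_of_notMem x hi, norm_zero, mul_zero]
    positivity

theorem eventually_stdVec (U : Ultrafilter I) :
    ∀ᶠ x in ((U.map stdVec : Ultrafilter (Ell2 I)) : Filter (Ell2 I)), ‖x‖ = 1 := by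
  rw [Ultrafilter.coe_map, eventually_map]
  exact Eventually.of_forall norm_stdVec

/-- A state of the diagonal algebra concentrated on an ultrafilter is the limit along it. -/
theorem tendsto_diagonal_state {φ : diagonalOperators I →ₗ[ℂ] ℂ}
    (hφ : φ ∈ states (diagonalOperators I)) {U : Ultrafilter I}
    (hU : ∀ E ∈ U, φ (diagonalProj E) = 1) (T : diagonalOperators I) :
    Tendsto (fun i => ⟪stdVec i, (T : BEll2 I) (stdVec i)⟫_ℂ) U (𝓝 (φ T)) := by
  obtain ⟨ℓ, hℓ⟩ := exists_tendsto_inner (eventually_stdVec U) (T : BEll2 I)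
  rw [Ultrafilter.coe_map, tendsto_map'_iff] at hℓ
  suffices φ T = ℓ by rwa [this]
  rw [← sub_eq_zero, ← norm_eq_zero]
  refine le_antisymm (le_of_forall_pos_le_add fun η hη => ?_) (norm_nonneg _)
  rw [zero_add]
  have hF : {i | ‖⟪stdVec i, (T : BEll2 I) (stdVec i)⟫_ℂ - ℓ‖ ≤ η} ∈ U := by
    filter_upwards [(Metric.tendsto_nhds.1 hℓ) η hη] with i hi
    rw [dist_eq_norm] at hi
    exact hi.le
  set F := {i | ‖⟪stdVec i, (T : BEll2 I) (stdVec i)⟫_ℂ - ℓ‖ ≤ η}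
  have h1 : φ T - ℓ = φ ((T - ℓ • 1) * diagonalProj F) := by
    rw [(states_mul_eq_of_eq_one hφ star_mul_self_nonneg_diagonal
      (isStarProjection_diagonalProj F) (hU F hF) _).2, map_sub, map_smul, hφ.1, smul_eq_mul,
      mul_one]
  rw [h1]
  refine norm_states_le hφ star_mul_self_nonneg_diagonal hη.le ?_
  exact sq_smul_one_sub_star_mul_self_nonneg
    (T := (T.1 - ℓ • (1 : BEll2 I)) * coordProj F)
    fun x => norm_mul_sub_coordProj_le T.2 hη.le (fun i hi => hi) x

theorem inner_diagonalProj_stdVec {E : Set I} {i : I} (hi : i ∈ E) :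
    ⟪stdVec i, coordProj E (stdVec i)⟫_ℂ = 1 := by
  rw [inner_stdVec_left, coordProj_apply_of_mem _ hi, stdVec_apply_self]

theorem states_diagonalProj_re_mem {φ : diagonalOperators I →ₗ[ℂ] ℂ}
    (hφ : φ ∈ states (diagonalOperators I)) (E : Set I) :
    0 ≤ φ (diagonalProj E) ∧ 0 ≤ 1 - φ (diagonalProj E) := by
  have key : ∀ F : Set I, 0 ≤ φ (diagonalProj F) := fun F => by
    have h := isStarProjection_diagonalProj F
    have := hφ.2 _ (star_mul_self_nonneg_diagonal (diagonalProj F))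
    rwa [h.isSelfAdjoint.star_eq, h.isIdempotentElem.eq] at this
  refine ⟨key E, ?_⟩
  have := key Eᶜ
  rwa [diagonalProj_compl, map_sub, hφ.1] at this

/-- Every ultrafilter yields a pure state on the diagonal algebra, namely the limit along it. -/
theorem exists_pureState_of_ultrafilter (U : Ultrafilter I) :
    ∃ ψ ∈ states (BEll2 I), restrictState ψ ∈ pureStates (diagonalOperators I) ∧
      ∀ T : BEll2 I, Tendsto (fun i => ⟪stdVec i, T (stdVec i)⟫_ℂ) U (𝓝 (ψ T)) := by
  obtain ⟨ψ, hψ, hlim⟩ := exists_limit_state (eventually_stdVec U)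
  simp only [Ultrafilter.coe_map, tendsto_map'_iff] at hlim
  refine ⟨ψ, hψ, ?_, hlim⟩
  have hφ := restrictState_mem hψ
  have hone : ∀ E ∈ U, restrictState ψ (diagonalProj E) = 1 := by
    intro E hE
    refine tendsto_nhds_unique (hlim (coordProj E)) (tendsto_const_nhds.congr' ?_)
    filter_upwards [hE] with i hi
    exact (inner_diagonalProj_stdVec hi).symm
  rw [pureStates, mem_extremePoints_iff_left]
  refine ⟨hφ, fun φ₁ h₁ φ₂ h₂ hseg => ?_⟩
  obtain ⟨a, b, ha, hb, hab, hsum⟩ := hseg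
  -- A proper convex combination of two numbers at most 1 equals 1 only if both do.
  have h₁one : ∀ E ∈ U, φ₁ (diagonalProj E) = 1 := by
    intro E hE
    have h := hone E hE
    rw [← hsum] at h
    obtain ⟨-, p₁⟩ := states_diagonalProj_re_mem h₁ E
    obtain ⟨-, p₂⟩ := states_diagonalProj_re_mem h₂ E
    have hre := congrArg Complex.re h
    simp only [LinearMap.add_apply, LinearMap.smul_apply, Complex.add_re, Complex.real_smul,
      Complex.re_ofReal_mul, Complex.one_re] at hre
    rw [Complex.nonneg_iff] at p₁ p₂
    simp only [Complex.sub_re, Complex.one_re, Complex.sub_im, Complex.one_im] at p₁ p₂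
    apply Complex.ext
    · rw [Complex.one_re]
      nlinarith [p₁.1, p₂.1, mul_nonneg hb.le p₂.1]
    · rw [Complex.one_im]
      linarith [p₁.2]
  ext T
  exact tendsto_nhds_unique (tendsto_diagonal_state h₁ h₁one T) (tendsto_diagonal_state hφ hone T)

/-- If `t = φ(P_E)` lay strictly between 0 and 1, `φ` would be the mixture, with weights `t` and `1
- t`, of its normalized cuts to `E` and `Eᶜ`. Extremality equates `φ` with the first cut, whose
value at `P_E` is 1. -/
theorem pureState_diagonalProj {φ : diagonalOperators I →ₗ[ℂ] ℂ}
    (hφ : φ ∈ pureStates (diagonalOperators I)) (E : Set I) :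
    φ (diagonalProj E) = 0 ∨ φ (diagonalProj E) = 1 := by
  rw [pureStates, mem_extremePoints_iff_left] at hφ
  obtain ⟨hst, hext⟩ := hφ
  by_contra! hne
  obtain ⟨h0, h1⟩ := states_diagonalProj_re_mem hst E
  obtain ⟨t, ht⟩ : ∃ t : ℝ, φ (diagonalProj E) = t :=
    ⟨_, Complex.ext (Complex.ofReal_re _).symm (Complex.nonneg_iff.1 h0).2.symm⟩
  rw [ht] at h0 h1 hne
  norm_cast at h0 h1 hne
  have ht0 : 0 < t := lt_of_le_of_ne h0 (Ne.symm hne.1)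
  have ht1 : 0 < 1 - t := lt_of_le_of_ne h1 (fun h => hne.2 (by linarith))
  let cut : ℝ → Set I → (diagonalOperators I →ₗ[ℂ] ℂ) := fun s F =>
    ((s⁻¹ : ℝ) : ℂ) • φ ∘ₗ LinearMap.mulLeft ℂ (diagonalProj F)
  have hcut : ∀ s F T, cut s F T = ((s⁻¹ : ℝ) : ℂ) * φ (diagonalProj F * T) := fun _ _ _ => rfl
  have hstate : ∀ (s : ℝ) (F : Set I), 0 < s → φ (diagonalProj F) = s →
      cut s F ∈ states (diagonalOperators I) := by
    intro s F hs hF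
    refine ⟨?_, fun T hT => ?_⟩
    · rw [hcut, mul_one, hF, ← Complex.ofReal_mul, inv_mul_cancel₀ hs.ne', Complex.ofReal_one]
    · rw [hcut]
      refine mul_nonneg (by exact_mod_cast (inv_pos.2 hs).le) (hst.2 _ ?_)
      have hP := isStarProjection_diagonalProj F
      -- Commutativity of the diagonal algebra makes the cut positive.
      have h2 : diagonalProj F * T = star (diagonalProj F) * T * diagonalProj F := by
        rw [mul_assoc, mul_comm_diagonal T, ← mul_assoc, hP.isSelfAdjoint.star_eq,
          hP.isIdempotentElem.eq]
      rw [h2]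
      exact star_left_conjugate_nonneg (show (0 : BEll2 I) ≤ T from hT) _
  have hcompl : φ (diagonalProj Eᶜ) = ((1 - t : ℝ) : ℂ) := by
    rw [diagonalProj_compl, map_sub, hst.1, ht]
    push_cast
    rfl
  have heq := hext _ (hstate t E ht0 ht) _ (hstate (1 - t) Eᶜ ht1 hcompl)
    ⟨t, 1 - t, ht0, ht1, by ring, by
      ext T
      simp only [LinearMap.add_apply, LinearMap.smul_apply, Complex.real_smul, hcut]
      rw [← mul_assoc, ← mul_assoc, ← Complex.ofReal_mul, ← Complex.ofReal_mul,
        mul_inv_cancel₀ ht0.ne', mul_inv_cancel₀ ht1.ne', Complex.ofReal_one, one_mul, one_mul,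
        ← map_add, ← add_mul, diagonalProj_compl, add_sub_cancel, one_mul]⟩
  have := congrArg (fun ρ : diagonalOperators I →ₗ[ℂ] ℂ => ρ (diagonalProj E)) heq
  simp only [hcut] at this
  rw [diagonalProj_mul, Set.inter_self, ht, ← Complex.ofReal_mul, inv_mul_cancel₀ ht0.ne'] at this
  exact hne.2 (by exact_mod_cast this.symm)

/-- Every pure state on the diagonal algebra is concentrated on an ultrafilter. -/
theorem exists_ultrafilter_of_pureState {φ : diagonalOperators I →ₗ[ℂ] ℂ}
    (hφ : φ ∈ pureStates (diagonalOperators I)) :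
    ∃ U : Ultrafilter I, ∀ E, E ∈ U ↔ φ (diagonalProj E) = 1 := by
  have hst : φ ∈ states (diagonalOperators I) := hφ.1
  have hmul : ∀ E F, φ (diagonalProj E) = 1 → φ (diagonalProj (E ∩ F)) = φ (diagonalProj F) := by
    intro E F h
    rw [← diagonalProj_mul]
    exact (states_mul_eq_of_eq_one hst star_mul_self_nonneg_diagonal
      (isStarProjection_diagonalProj E) h _).1
  let ℱ : Filter I :=
    { sets := {E | φ (diagonalProj E) = 1}
      univ_sets := by
        change φ (diagonalProj Set.univ) = 1
        rw [diagonalProj_univ, hst.1]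
      sets_of_superset := by
        intro E F hE hEF
        have := hmul E F hE
        rw [Set.inter_eq_left.2 hEF] at this
        exact this.symm.trans hE
      inter_sets := fun {E F} hE hF => (hmul E F hE).trans hF }
  have hmem : ∀ E, E ∈ ℱ ↔ φ (diagonalProj E) = 1 := fun _ => Iff.rfl
  refine ⟨Ultrafilter.ofComplNotMemIff ℱ fun E => ?_, hmem⟩
  rw [hmem, hmem, diagonalProj_compl, map_sub, hst.1]
  rcases pureState_diagonalProj hφ E with h | h <;> simp [h]

end Ell2States

/-! ### From unique extension to uniform decomposability. -/

section FromKadisonSinger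

theorem KadisonSinger.exists_mem_boundedBelowOn (hKS : KadisonSinger) {Q : BEll2 ℕ} {a c : ℝ}
    (hc : c < a) (hQ : ∀ i, a ≤ (⟪Q (stdVec i), stdVec i⟫_ℂ).re) (U : Ultrafilter ℕ) :
    ∃ E ∈ U, BoundedBelowOn Q c E := by
  by_contra! hbad
  let B : Set ℕ → Set (Ell2 ℕ) := fun E =>
    {x | ‖x‖ = 1 ∧ x ∈ coordSubspace E ∧ (⟪x, Q x⟫_ℂ).re ≤ c}
  have hBmono : Monotone B := fun E F hEF x hx => ⟨hx.1, coordSubspace_mono hEF hx.2.1, hx.2.2⟩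
  -- Failure of the bound on each `E ∈ U` supplies, after normalization, a unit vector in `B E`.
  have hB : ((U : Filter ℕ).lift' B).NeBot := by
    rw [lift'_neBot_iff hBmono]
    intro E hE
    have := hbad E hE
    simp only [BoundedBelowOn, not_forall, not_le] at this
    obtain ⟨f, hf, hlt⟩ := this
    have hf0 : f ≠ 0 := by
      rintro rfl
      simp at hlt
    have hn : 0 < ‖f‖ := norm_pos_iff.2 hf0
    refine ⟨((‖f‖⁻¹ : ℝ) : ℂ) • f, ?_, Submodule.smul_mem _ _ hf, ?_⟩
    · rw [norm_smul, Complex.norm_real, norm_inv, norm_norm, inv_mul_cancel₀ hn.ne']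
    · rw [map_smul, inner_smul_left, inner_smul_right, Complex.conj_ofReal,
        Complex.re_ofReal_mul, Complex.re_ofReal_mul]
      have h1 : (⟪f, Q f⟫_ℂ).re = (⟪Q f, f⟫_ℂ).re := inner_re_symm (𝕜 := ℂ) _ _
      rw [h1, ← mul_assoc, ← sq, inv_pow, inv_mul_le_iff₀ (by positivity), mul_comm]
      exact hlt.le
  let 𝒱 := Ultrafilter.of ((U : Filter ℕ).lift' B)
  have hmem : ∀ F ∈ U, ∀ᶠ x in (𝒱 : Filter (Ell2 ℕ)), x ∈ B F := fun F hF =>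
    Ultrafilter.of_le _ (mem_lift' hF)
  obtain ⟨ψ, hψ, hψlim⟩ := exists_limit_state
    ((hmem Set.univ univ_mem).mono fun x hx => hx.1)
  obtain ⟨ψ', hψ', hpure, hψ'lim⟩ := exists_pureState_of_ultrafilter U
  -- Vectors supported where the entries of `T` are within `η / 2` of their limit give nearly that
  -- limit.
  have hext : ∀ T : diagonalOperators ℕ, ψ (T : BEll2 ℕ) = restrictState ψ' T := by
    intro T
    refine tendsto_nhds_unique (hψlim T) (Metric.tendsto_nhds.2 fun η hη => ?_)
    have hF := (Metric.tendsto_nhds.1 (hψ'lim T)) (η / 2) (half_pos hη)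
    filter_upwards [hmem _ hF] with x hx
    have h1 := norm_mul_sub_coordProj_le T.2 (half_pos hη).le
      (ℓ := restrictState ψ' T)
      (F := {i | dist ⟪stdVec i, (T : BEll2 ℕ) (stdVec i)⟫_ℂ (ψ' T) < η / 2})
      (fun i hi => by
        have := (Set.mem_ofPred_eq ▸ hi : dist _ _ < η / 2)
        rw [dist_eq_norm] at this
        exact this.le) x
    rw [coordProj_of_mem hx.2.1, hx.1, mul_one] at h1
    have h2 : ⟪x, (T : BEll2 ℕ) x⟫_ℂ - restrictState ψ' T =
        ⟪x, ((T : BEll2 ℕ) - restrictState ψ' T • (1 : BEll2 ℕ)) x⟫_ℂ := by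
      have : ((T : BEll2 ℕ) - restrictState ψ' T • (1 : BEll2 ℕ)) x =
        (T : BEll2 ℕ) x - restrictState ψ' T • x := rfl
      rw [this, inner_sub_right, inner_smul_right, inner_self_eq_norm_sq_to_K, hx.1]
      simp
    rw [dist_eq_norm, h2]
    refine ((norm_inner_le_norm _ _).trans ?_).trans_lt (half_lt_self hη)
    rwa [hx.1, one_mul]
  have heq : ψ = ψ' := (hKS _ hpure).unique ⟨hψ, hext⟩ ⟨hψ', fun _ => rfl⟩
  have hle : (ψ Q).re ≤ c := by
    refine le_of_tendsto ((Complex.continuous_re.tendsto _).comp (hψlim Q)) ?_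
    filter_upwards [hmem Set.univ univ_mem] with x hx using hx.2.2
  have hge : a ≤ (ψ' Q).re := by
    refine ge_of_tendsto' ((Complex.continuous_re.tendsto _).comp (hψ'lim Q)) fun i => ?_
    exact (hQ i).trans_eq (inner_re_symm (𝕜 := ℂ) _ _)
  rw [heq] at hle
  linarith

theorem KadisonSinger.exists_coloring (hKS : KadisonSinger) {Q : BEll2 ℕ} {a c : ℝ}
    (hc : c < a) (hQ : ∀ i, a ≤ (⟪Q (stdVec i), stdVec i⟫_ℂ).re) :
    ∃ (r : ℕ) (χ : ℕ → Fin r), ∀ k, BoundedBelowOn Q c (χ ⁻¹' {k}) := by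
  -- If complements of good sets generated a proper filter, an ultrafilter above it would contain no
  -- good set.
  let G : Set (Set ℕ) := {E | BoundedBelowOn Q c Eᶜ}
  have hnot : ¬ (generate G).NeBot := by
    intro hne
    obtain ⟨E, hE, hgood⟩ := hKS.exists_mem_boundedBelowOn hc hQ (Ultrafilter.of (generate G))
    have hc : Eᶜ ∈ Ultrafilter.of (generate G) :=
      Ultrafilter.of_le _ (mem_generate_of_mem (by simpa [G] using hgood))
    exact Ultrafilter.compl_notMem_iff.2 hE hc
  rw [generate_neBot_iff] at hnot
  push Not at hnot
  obtain ⟨t, htG, htfin, hempty⟩ := hnot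
  have hex : ∀ i, ∃ s : t, i ∉ (s : Set ℕ) := by
    intro i
    by_contra! h
    have : i ∈ ⋂₀ t := fun s hs => h ⟨s, hs⟩
    rw [hempty] at this
    exact this
  -- Each `i` is colored by a member of `t` omitting it, so a color class lies in the complement of
  -- that member.
  choose σ hσ using hex
  have : Finite t := htfin
  obtain ⟨r, ⟨e⟩⟩ := Finite.exists_equiv_fin t
  refine ⟨r, fun i => e (σ i), fun k => ?_⟩
  refine (show BoundedBelowOn Q c (e.symm k : Set ℕ)ᶜ from htG (e.symm k).2).mono fun i hi => ?_
  have hi' : e (σ i) = k := hi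
  rw [← hi', e.symm_apply_apply]
  exact hσ i

/-- Kadison–Singer yields a uniform bound on the number of colors for large subspaces. -/
theorem KadisonSinger.exists_uniform_coloring (hKS : KadisonSinger) {A c : ℝ} (hA : 0 < A)
    (hA1 : A ≤ 1) (hc : c < A ^ 2) :
    ∃ r : ℕ, ∀ (I : Type u) (H : Submodule ℂ (Ell2 I)) [H.HasOrthogonalProjection],
      IsALarge A H → ∃ χ : I → Fin r, ∀ k, BoundedBelowOn H.starProjection c (χ ⁻¹' {k}) := by
  -- This yields a counterexample `H r` for every `r`; next, a finite set `S r` on which it already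
  -- fails.
  by_contra! hbad
  choose I H hproj hlarge hno using hbad
  have hfin : ∀ r, ∃ S : Finset (I r), ∀ χ : I r → Fin r, ∃ k,
      ¬ BoundedBelowOn (H r).starProjection c (↑S ∩ χ ⁻¹' {k}) := by
    intro r
    by_contra! h
    obtain ⟨χ, hχ⟩ := exists_coloring_of_finset h
    obtain ⟨k, hk⟩ := hno r χ
    exact hk (hχ k)
  choose S hS using hfin
  let D := directSumSubspace H
  have hDlarge : IsALarge A D := isALarge_directSumSubspace hA hlarge
  have : CompleteSpace D := hDlarge.2.1.completeSpace_coe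
  let m : (Σ r, {i // i ∈ S r}) ↪ Σ r, I r :=
    Function.Embedding.sigmaMap (.refl ℕ) fun r => Function.Embedding.subtype (· ∈ S r)
  obtain ⟨κ⟩ := nonempty_embedding_nat (Σ r, {i // i ∈ S r})
  -- The projection compressed to all the `S r`, completed by the identity on unused coordinates to
  -- keep every diagonal entry at least `A ^ 2`.
  let Q : BEll2 ℕ := (extendL κ ∘L restrictL m ∘L D.starProjection ∘L extendL m ∘L restrictL κ) +
    (1 - extendL κ ∘L restrictL κ)
  have hQapply : ∀ f, Q f = extendL κ (restrictL m (D.starProjection (extendL m (restrictL κ f)))) +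
    (f - extendL κ (restrictL κ f)) := fun _ => rfl
  have hQdiag : ∀ i, A ^ 2 ≤ (⟪Q (stdVec i), stdVec i⟫_ℂ).re := by
    intro i
    rw [hQapply]
    by_cases hi : i ∈ Set.range κ
    · obtain ⟨s, rfl⟩ := hi
      rw [restrictL_stdVec, extendL_stdVec, extendL_stdVec, sub_self, add_zero, inner_extendL_left,
        restrictL_stdVec, ← inner_extendL_right, extendL_stdVec]
      exact hDlarge.sq_le_re_inner _
    · rw [restrictL_stdVec_of_notMem κ hi]
      simp only [map_zero, zero_add, sub_zero]
      rw [inner_stdVec_left, stdVec_apply_self, Complex.one_re]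
      exact pow_le_one₀ hA.le hA1
  obtain ⟨r, χ, hχ⟩ := hKS.exists_coloring hc hQdiag
  classical
  -- The number of colors found for `Q` selects the block to contradict. Colors off `S r` are
  -- irrelevant; `χ 0` is a filler.
  obtain ⟨k, hk⟩ := hS r fun i => if h : i ∈ S r then χ (κ ⟨r, i, h⟩) else χ 0
  refine hk fun f hf => ?_
  set v := extendL (Function.Embedding.sigmaMk r) f
  have hv : v ∈ coordSubspace (Set.range m) := by
    refine extendL_mem_coordSubspace _ fun i hi => hf i fun h => hi ?_
    exact ⟨⟨r, i, h.1⟩, rfl⟩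
  have hmv : extendL m (restrictL m v) = v := extendL_restrictL m hv
  have hmem : extendL κ (restrictL m v) ∈ coordSubspace (χ ⁻¹' {k}) := by
    refine extendL_mem_coordSubspace _ ?_
    rintro ⟨s, i, his⟩ hi
    change v ⟨s, i⟩ = 0
    by_cases hs : s = r
    · subst hs
      refine (extendL_apply (Function.Embedding.sigmaMk s) f i).trans (hf i fun h => hi ?_)
      have h2 := h.2
      simp only [Set.mem_preimage, Set.mem_singleton_iff] at h2
      rwa [dif_pos his] at h2
    · refine extendL_apply_of_notMem _ _ ?_
      rintro ⟨j, hj⟩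
      exact hs (congrArg Sigma.fst hj).symm
  have h := hχ k _ hmem
  have hnorm : ‖restrictL m v‖ = ‖f‖ := by
    rw [← norm_extendL m, hmv, norm_extendL]
  rw [hQapply, restrictL_extendL, sub_self, add_zero, hmv, inner_extendL_left, restrictL_extendL,
    ← inner_extendL_right, hmv, norm_extendL, hnorm, starProjection_directSumSubspace_extendL,
    inner_extendL_left, restrictL_extendL] at h
  exact h

theorem KadisonSinger.exists_isRDecomposable (hKS : KadisonSinger) {A : ℝ} (hA : 0 < A)
    (hA1 : A < 1) :
    ∃ r : ℕ, ∀ (I : Type u) (H : Submodule ℂ (Ell2 I)), IsALarge A H → IsRDecomposable r H := by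
  obtain ⟨r, hr⟩ := hKS.exists_uniform_coloring hA hA1.le
    (show A ^ 2 / 2 < A ^ 2 from half_lt_self (by positivity))
  refine ⟨r, fun I H hH => ?_⟩
  have : CompleteSpace H := hH.2.1.completeSpace_coe
  obtain ⟨χ, hχ⟩ := hr I H hH
  exact isRDecomposable_of_boundedBelowOn (by positivity) χ hχ

end FromKadisonSinger

/-! ### From decomposability to unique extension. -/

section ToKadisonSinger

variable {I : Type*}

/-- Self-adjoint operators with zero diagonal whose quadratic form is bounded by one. -/
structure IsHollowContraction (T : BEll2 I) : Prop where
  isSelfAdjoint : IsSelfAdjoint T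
  diag_eq_zero : ∀ i, ⟪stdVec i, T (stdVec i)⟫_ℂ = 0
  abs_re_inner_le : ∀ x, |(⟪T x, x⟫_ℂ).re| ≤ ‖x‖ ^ 2

theorem IsHollowContraction.neg {T : BEll2 I} (h : IsHollowContraction T) :
    IsHollowContraction (-T) where
  isSelfAdjoint := h.isSelfAdjoint.neg
  diag_eq_zero i := by simp [h.diag_eq_zero i]
  abs_re_inner_le x := by simpa using h.abs_re_inner_le x

theorem isHollowContraction_zero : IsHollowContraction (0 : BEll2 I) where
  isSelfAdjoint := IsSelfAdjoint.zero _
  diag_eq_zero i := by simp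
  abs_re_inner_le x := by simp

theorem exists_selfAdjoint_sqrt {H : Type*} [NormedAddCommGroup H] [InnerProductSpace ℂ H]
    [CompleteSpace H] {T : H →L[ℂ] H} (hT : 0 ≤ T) :
    ∃ S : H →L[ℂ] H, IsSelfAdjoint S ∧ S * S = T :=
  ⟨CFC.sqrt T, (CFC.sqrt_nonneg T).isSelfAdjoint, CFC.sqrt_mul_sqrt_self T hT⟩

theorem exists_sqrt_half {T : BEll2 I} (hT : IsSelfAdjoint T)
    (h : ∀ x, |(⟪T x, x⟫_ℂ).re| ≤ ‖x‖ ^ 2) :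
    ∃ S : BEll2 I, IsSelfAdjoint S ∧ S * S = (1 / 2 : ℂ) • (1 + T) := by
  have hnn : 0 ≤ (1 / 2 : ℂ) • (1 + T) := by
    refine smul_nonneg (by norm_num [Complex.nonneg_iff]) ?_
    rw [nonneg_BEll2_iff]
    refine ⟨(IsSelfAdjoint.one _).add hT, fun x => ?_⟩
    have h1 : (1 + T) x = x + T x := rfl
    have h2 : (⟪x, x⟫_ℂ).re = ‖x‖ ^ 2 := inner_self_eq_norm_sq (𝕜 := ℂ) x
    rw [h1, inner_add_left, Complex.add_re, h2]
    linarith [(abs_le.1 (h x)).1]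
  exact exists_selfAdjoint_sqrt hnn

theorem re_inner_self_eq (x : Ell2 I) : (⟪x, x⟫_ℂ).re = ‖x‖ ^ 2 :=
  inner_self_eq_norm_sq (𝕜 := ℂ) x

theorem norm_sq_map_of_isSelfAdjoint {S : BEll2 I} (hS : IsSelfAdjoint S) (x : Ell2 I) :
    ‖S x‖ ^ 2 = (⟪(S * S) x, x⟫_ℂ).re := by
  have h1 : (S * S) x = S (S x) := rfl
  rw [h1, ← ContinuousLinearMap.adjoint_inner_right, hS.adjoint_eq, re_inner_self_eq]

theorem restrictL_extendL_of_disjoint {J K : Type*} (e : J ↪ I) (e' : K ↪ I)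
    (h : ∀ j k, e j ≠ e' k) (u : Ell2 K) : restrictL e (extendL e' u) = 0 := by
  ext j
  rw [restrictL_apply, extendL_apply_of_notMem]
  · rfl
  · rintro ⟨k, hk⟩
    exact h j k hk.symm

/-- The column operator `x ↦ (A x, B x)`. -/
noncomputable def columnL (A B : BEll2 I) : Ell2 I →L[ℂ] Ell2 (I ⊕ I) :=
  extendL Function.Embedding.inl ∘L A + extendL Function.Embedding.inr ∘L B

theorem columnL_apply_inl (A B : BEll2 I) (x : Ell2 I) (i : I) :
    columnL A B x (Sum.inl i) = A x i := by
  have h1 := extendL_apply (Function.Embedding.inl : I ↪ I ⊕ I) (A x) i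
  have h2 := extendL_apply_of_notMem (Function.Embedding.inr : I ↪ I ⊕ I) (B x) (i := Sum.inl i)
    (by rintro ⟨j, hj⟩; exact Sum.inr_ne_inl hj)
  change extendL Function.Embedding.inl (A x) (Sum.inl i) +
    extendL Function.Embedding.inr (B x) (Sum.inl i) = _
  rw [h2, add_zero]
  exact h1

theorem columnL_apply_inr (A B : BEll2 I) (x : Ell2 I) (i : I) :
    columnL A B x (Sum.inr i) = B x i := by
  have h1 := extendL_apply (Function.Embedding.inr : I ↪ I ⊕ I) (B x) i
  have h2 := extendL_apply_of_notMem (Function.Embedding.inl : I ↪ I ⊕ I) (A x) (i := Sum.inr i)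
    (by rintro ⟨j, hj⟩; exact Sum.inl_ne_inr hj)
  change extendL Function.Embedding.inl (A x) (Sum.inr i) +
    extendL Function.Embedding.inr (B x) (Sum.inr i) = _
  rw [h2, zero_add]
  exact h1

theorem norm_columnL {A B : BEll2 I} (hA : IsSelfAdjoint A) (hB : IsSelfAdjoint B)
    (h : A * A + B * B = 1) (x : Ell2 I) : ‖columnL A B x‖ = ‖x‖ := by
  rw [← sq_eq_sq₀ (norm_nonneg _) (norm_nonneg _)]
  have horth : ⟪extendL (Function.Embedding.inl : I ↪ I ⊕ I) (A x),
      extendL (Function.Embedding.inr : I ↪ I ⊕ I) (B x)⟫_ℂ = 0 := by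
    rw [inner_extendL_left, restrictL_extendL_of_disjoint _ _ (fun j k => Sum.inl_ne_inr),
      inner_zero_right]
  have h1 : columnL A B x = extendL (Function.Embedding.inl : I ↪ I ⊕ I) (A x) +
    extendL (Function.Embedding.inr : I ↪ I ⊕ I) (B x) := rfl
  rw [h1, sq, norm_add_sq_eq_norm_sq_add_norm_sq_of_inner_eq_zero _ _ horth, norm_extendL,
    norm_extendL, ← sq, ← sq, norm_sq_map_of_isSelfAdjoint hA, norm_sq_map_of_isSelfAdjoint hB,
    ← Complex.add_re, ← inner_add_left, ← add_apply, h, ← re_inner_self_eq]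
  rfl

theorem norm_sq_sqrt_half {T A : BEll2 I} (hA : IsSelfAdjoint A)
    (hA2 : A * A = (1 / 2 : ℂ) • (1 + T)) (x : Ell2 I) :
    ‖A x‖ ^ 2 = (‖x‖ ^ 2 + (⟪T x, x⟫_ℂ).re) / 2 := by
  have h1 : ((1 / 2 : ℂ) • (1 + T)) x = ((1 / 2 : ℝ) : ℂ) • (x + T x) := by
    push_cast
    rfl
  rw [norm_sq_map_of_isSelfAdjoint hA, hA2, h1, inner_smul_left, Complex.conj_ofReal,
    Complex.re_ofReal_mul, inner_add_left, Complex.add_re, re_inner_self_eq]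
  ring

/-- Zero diagonal gives `‖S e_i‖ ^ 2 = 1 / 2` for either root `S`. The image of the normalized
vector `S e_i` has norm 1 and corresponding coordinate of modulus `‖S e_i‖ ≥ 1 / 2`. -/
theorem isALarge_range_columnL {T A B : BEll2 I} (hT : IsHollowContraction T)
    (hA : IsSelfAdjoint A) (hA2 : A * A = (1 / 2 : ℂ) • (1 + T))
    (hB : IsSelfAdjoint B) (hB2 : B * B = (1 / 2 : ℂ) • (1 + -T))
    (hnorm : ∀ x, ‖columnL A B x‖ = ‖x‖) :
    IsALarge (1 / 2) (LinearMap.range (columnL A B).toLinearMap) := by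
  refine ⟨by norm_num, ?_, ?_⟩
  · let V : Ell2 I →ₗᵢ[ℂ] Ell2 (I ⊕ I) := ⟨(columnL A B).toLinearMap, hnorm⟩
    exact V.isometry.isClosedEmbedding.isClosed_range
  have key : ∀ (S : BEll2 I) (T' : BEll2 I), IsHollowContraction T' → IsSelfAdjoint S →
      S * S = (1 / 2 : ℂ) • (1 + T') → ∀ i, ‖S (stdVec i)‖ ^ 2 = 1 / 2 := by
    intro S T' hT' hS hS2 i
    rw [norm_sq_sqrt_half hS hS2, norm_stdVec, ← inner_conj_symm, hT'.diag_eq_zero]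
    simp
  have main : ∀ (S : BEll2 I) (i : I) (j : I ⊕ I), IsSelfAdjoint S → ‖S (stdVec i)‖ ^ 2 = 1 / 2 →
      (∀ x, columnL A B x j = S x i) →
      ∃ f ∈ LinearMap.range (columnL A B).toLinearMap, ‖f‖ = 1 ∧ 1 / 2 ≤ ‖f j‖ := by
    intro S i j hS hn hj
    set n := ‖S (stdVec i)‖
    have hn0 : 0 < n := lt_of_le_of_ne (norm_nonneg _) (by rintro h; rw [← h] at hn; norm_num at hn)
    refine ⟨columnL A B (((n⁻¹ : ℝ) : ℂ) • S (stdVec i)), ⟨_, rfl⟩, ?_, ?_⟩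
    · rw [hnorm, norm_smul, Complex.norm_real, norm_inv, norm_norm, inv_mul_cancel₀ hn0.ne']
    · have h1 : ‖S (S (stdVec i)) i‖ = n ^ 2 := by
        rw [← inner_stdVec_left, ← ContinuousLinearMap.adjoint_inner_left, hS.adjoint_eq,
          inner_self_eq_norm_sq_to_K]
        simp [n]
      have h2 : S (((n⁻¹ : ℝ) : ℂ) • S (stdVec i)) i = ((n⁻¹ : ℝ) : ℂ) * S (S (stdVec i)) i := by
        rw [map_smul]
        rfl
      rw [hj, h2, norm_mul, h1, Complex.norm_real, norm_inv, Real.norm_of_nonneg hn0.le, sq,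
        inv_mul_cancel_left₀ hn0.ne']
      nlinarith
  rintro (i | i)
  · exact main A i _ hA (key A T hT hA hA2 i) fun x => columnL_apply_inl A B x i
  · exact main B i _ hB (key B (-T) hT.neg hB hB2 i) fun x => columnL_apply_inr A B x i

/-- The positive square roots of `(1 ± T) / 2` form an isometric column with large range. -/
theorem exists_column {T : BEll2 I} (hT : IsHollowContraction T) :
    ∃ A B : BEll2 I, IsSelfAdjoint A ∧ A * A = (1 / 2 : ℂ) • (1 + T) ∧
      (∀ x, ‖columnL A B x‖ = ‖x‖) ∧
      IsALarge (1 / 2) (LinearMap.range (columnL A B).toLinearMap) := by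
  obtain ⟨A, hA, hA2⟩ := exists_sqrt_half hT.isSelfAdjoint hT.abs_re_inner_le
  obtain ⟨B, hB, hB2⟩ := exists_sqrt_half hT.neg.isSelfAdjoint hT.neg.abs_re_inner_le
  have hsum : A * A + B * B = 1 := by
    rw [hA2, hB2, ← smul_add]
    have : (1 + T) + (1 + -T) = (2 : ℂ) • (1 : BEll2 I) := by
      rw [two_smul]; abel
    rw [this, smul_smul]
    norm_num
  have hnorm := norm_columnL hA hB hsum
  exact ⟨A, B, hA, hA2, hnorm, isALarge_range_columnL hT hA hA2 hB hB2 hnorm⟩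

theorem re_inner_eq_of_eqOn {E : Set I} {f u : Ell2 I} (hf : f ∈ coordSubspace E)
    (h : ∀ i ∈ E, u i = f i) : (⟪f, u⟫_ℂ).re = ‖f‖ ^ 2 := by
  rw [← (coordProj_eq_iff hf).2 h]
  exact re_inner_starProjection_self u

/-- A single direct sum encodes the whole sequence, so one decomposition gives `δ` and `r`
independent of `n`. -/
theorem exists_uniform_boundedBelowOn {T : ℕ → BEll2 I}
    (hdec : ∀ H : Submodule ℂ (Ell2 (Σ _ : ℕ, I ⊕ I)), IsLarge H → IsFinitelyDecomposable H)
    (hT : ∀ n, IsHollowContraction (T n)) :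
    ∃ δ > 0, ∃ r : ℕ, ∀ n, ∃ E : Fin r → Set I, (⋃ j, E j) = Set.univ ∧
      ∀ j, BoundedBelowOn (T n) (δ - 1) (E j) := by
  choose A B hA hA2 hnorm hlarge using fun n => exists_column (hT n)
  let H : ∀ _ : ℕ, Submodule ℂ (Ell2 (I ⊕ I)) := fun n =>
    LinearMap.range (columnL (A n) (B n)).toLinearMap
  obtain ⟨r, hclosed, E, -, hcover, hE⟩ := hdec (directSumSubspace H)
    ⟨1 / 2, isALarge_directSumSubspace (by norm_num) hlarge⟩
  choose C hC hlift using fun j => exists_bounded_lift hclosed (hE j)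
  -- A common lifting constant, positive even if there are no pieces.
  let M : ℝ := 1 + ∑ j, C j
  have hM : 0 < M := add_pos_of_pos_of_nonneg one_pos (Finset.sum_nonneg fun j _ => (hC j).le)
  have hCM : ∀ j, C j ≤ M := fun j =>
    (Finset.single_le_sum (fun j _ => (hC j).le) (Finset.mem_univ j)).trans (by simp [M])
  refine ⟨2 / M ^ 2, by positivity, r, fun n => ?_⟩
  let ι : I ↪ Σ _ : ℕ, I ⊕ I :=
    Function.Embedding.inl.trans (Function.Embedding.sigmaMk (β := fun _ : ℕ => I ⊕ I) n)
  refine ⟨fun j => ι ⁻¹' E j, by rw [← Set.preimage_iUnion, hcover, Set.preimage_univ],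
    fun j f hf => ?_⟩
  obtain ⟨h, hh, hhf, hle⟩ := hlift j (extendL ι f) (extendL_mem_coordSubspace ι hf)
  obtain ⟨x, hx⟩ := mem_directSumSubspace.1 hh n
  have hx' : columnL (A n) (B n) x = restrictL (Function.Embedding.sigmaMk n) h := hx
  have hxle : ‖x‖ ≤ M * ‖f‖ := by
    rw [← hnorm n x, hx']
    refine (norm_restrictL_le _ _).trans (hle.trans ?_)
    rw [norm_extendL]
    exact mul_le_mul_of_nonneg_right (hCM j) (norm_nonneg _)
  have hAx : ∀ i ∈ ι ⁻¹' E j, A n x i = f i := by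
    intro i hi
    rw [← columnL_apply_inl (A n) (B n), hx', restrictL_apply]
    exact (hhf (ι i) hi).trans (extendL_apply ι f i)
  -- Duality: as `A n x` agrees with `f` on the piece, `‖f‖ ^ 2` is the real part of `⟪A n f, x⟫`.
  have h1 : ‖f‖ ^ 2 ≤ ‖A n f‖ * (M * ‖f‖) := by
    rw [← re_inner_eq_of_eqOn hf hAx, ← ContinuousLinearMap.adjoint_inner_left,
      (hA n).adjoint_eq]
    exact (Complex.re_le_norm _).trans ((norm_inner_le_norm _ _).trans
      (mul_le_mul_of_nonneg_left hxle (norm_nonneg _)))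
  have h2 : ‖f‖ ≤ M * ‖A n f‖ := by
    rcases (norm_nonneg f).eq_or_lt with h0 | h0
    · rw [← h0]
      positivity
    · refine le_of_mul_le_mul_right ?_ h0
      linarith
  have h3 : ‖f‖ ^ 2 ≤ M ^ 2 * ((‖f‖ ^ 2 + (⟪T n f, f⟫_ℂ).re) / 2) := by
    rw [← norm_sq_sqrt_half (hA n) (hA2 n), ← mul_pow]
    exact pow_le_pow_left₀ (norm_nonneg _) h2 2
  have h4 : 2 / M ^ 2 * ‖f‖ ^ 2 ≤ ‖f‖ ^ 2 + (⟪T n f, f⟫_ℂ).re := by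
    rw [div_mul_eq_mul_div, div_le_iff₀ (by positivity)]
    linarith
  linarith

/-- The diagonal part of a bounded operator. -/
theorem exists_diagonalPart (T : BEll2 I) : ∃ D : diagonalOperators I,
    ∀ i, ⟪stdVec i, (D : BEll2 I) (stdVec i)⟫_ℂ = ⟪stdVec i, T (stdVec i)⟫_ℂ := by
  let d : I → ℂ := fun i => ⟪stdVec i, T (stdVec i)⟫_ℂ
  have hd : ∀ (f : Ell2 I) i, ‖d i * f i‖ ^ 2 ≤ ‖T‖ ^ 2 * ‖f i‖ ^ 2 := by
    intro f i
    rw [← mul_pow, norm_mul]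
    exact pow_le_pow_left₀ (by positivity) (mul_le_mul_of_nonneg_right
      (norm_inner_map_self_le (norm_stdVec i)) (norm_nonneg _)) 2
  let L : Ell2 I →ₗ[ℂ] Ell2 I :=
    { toFun := fun f => ⟨fun i => d i * f i, memℓp_two_of_summable
        (((summable_norm_sq f).mul_left (‖T‖ ^ 2)).of_nonneg_of_le (fun _ => by positivity) (hd f))⟩
      map_add' := fun f g => lp.ext (funext fun i => mul_add _ _ _)
      map_smul' := fun c f => lp.ext (funext fun i => mul_left_comm _ _ _) }
  let D : BEll2 I := L.mkContinuous ‖T‖ fun f => norm_le_of_coord_le (norm_nonneg _) fun i => by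
    change ‖d i * f i‖ ≤ _
    rw [norm_mul]
    exact mul_le_mul_of_nonneg_right (norm_inner_map_self_le (norm_stdVec i)) (norm_nonneg _)
  refine ⟨⟨D, d, fun f i => rfl⟩, fun i => ?_⟩
  rw [inner_stdVec_left]
  change d i * stdVec i i = d i
  rw [stdVec_apply_self, mul_one]

/-- The two lower bounds say that the quadratic form of `T` is at most `b` in modulus on `ℓ₂(G)`, so
the compression may be divided by `b`. -/
theorem IsHollowContraction.compress {T : BEll2 I} (h : IsHollowContraction T) {G : Set I}
    {b : ℝ} (hb : 0 < b) (h₁ : BoundedBelowOn T (-b) G) (h₂ : BoundedBelowOn (-T) (-b) G) :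
    IsHollowContraction (((b⁻¹ : ℝ) : ℂ) • (coordProj G * T * coordProj G)) := by
  have happ : ∀ x, (((b⁻¹ : ℝ) : ℂ) • (coordProj G * T * coordProj G)) x =
    ((b⁻¹ : ℝ) : ℂ) • coordProj G (T (coordProj G x)) := fun _ => rfl
  have hP : ∀ x y, ⟪coordProj G x, y⟫_ℂ = ⟪x, coordProj G y⟫_ℂ :=
    Submodule.inner_starProjection_left_eq_right _
  refine ⟨?_, fun i => ?_, fun x => ?_⟩
  · have hPs := (isStarProjection_coordProj G).isSelfAdjoint.star_eq
    rw [isSelfAdjoint_iff, star_smul, star_mul, star_mul, hPs, h.isSelfAdjoint.star_eq,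
      Complex.star_def, Complex.conj_ofReal, mul_assoc]
  · rw [happ, inner_smul_right, ← hP]
    by_cases hi : i ∈ G
    · have : coordProj G (stdVec i) = stdVec i := coordProj_of_mem fun j hj =>
        stdVec_apply_ne fun hij => hj (hij ▸ hi)
      rw [this, h.diag_eq_zero, mul_zero]
    · have : coordProj G (stdVec i) = 0 := (coordProj_eq_iff (zero_mem _)).2 fun j hj =>
        stdVec_apply_ne fun hij => hi (hij ▸ hj)
      rw [this, inner_zero_left, mul_zero]
  · have hmem := coordProj_mem G x
    have hle : ‖coordProj G x‖ ^ 2 ≤ ‖x‖ ^ 2 :=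
      pow_le_pow_left₀ (norm_nonneg _) (Submodule.norm_starProjection_apply_le _ _) 2
    have g₁ := h₁ _ hmem
    have g₂ := h₂ _ hmem
    rw [neg_apply, inner_neg_left, Complex.neg_re] at g₂
    rw [happ, inner_smul_left, hP, Complex.conj_ofReal, Complex.re_ofReal_mul, abs_mul,
      abs_of_pos (inv_pos.2 hb), inv_mul_le_iff₀ hb]
    have : |(⟪T (coordProj G x), coordProj G x⟫_ℂ).re| ≤ b * ‖coordProj G x‖ ^ 2 :=
      abs_le.2 ⟨by linarith, by linarith⟩
    exact this.trans (mul_le_mul_of_nonneg_left hle hb.le)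

theorem states_re_le_one {ψ : BEll2 I →ₗ[ℂ] ℂ} (hψ : ψ ∈ states (BEll2 I)) {T : BEll2 I}
    (hT : IsHollowContraction T) : (ψ T).re ≤ 1 := by
  have h : 0 ≤ 1 - T := by
    rw [nonneg_BEll2_iff]
    refine ⟨(IsSelfAdjoint.one _).sub hT.isSelfAdjoint, fun x => ?_⟩
    have h1 : (1 - T) x = x - T x := rfl
    rw [h1, inner_sub_left, Complex.sub_re, re_inner_self_eq]
    linarith [(abs_le.1 (hT.abs_re_inner_le x)).2]
  have := (Complex.nonneg_iff.1 (hψ.2 _ h)).1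
  rw [map_sub, hψ.1, Complex.sub_re, Complex.one_re] at this
  linarith

theorem exists_mem_of_iUnion_eq_univ {r : ℕ} {E : Fin r → Set I} (h : (⋃ j, E j) = Set.univ)
    (U : Ultrafilter I) : ∃ j, E j ∈ U := by
  have h1 : (⋃ j ∈ (Set.univ : Set (Fin r)), E j) ∈ U := by
    simp only [Set.mem_univ, Set.iUnion_true, h]
    exact univ_mem
  obtain ⟨j, -, hj⟩ := (Ultrafilter.finite_biUnion_mem_iff Set.finite_univ).1 h1
  exact ⟨j, hj⟩

/-- A state concentrated on an ultrafilter is nonpositive on hollow contractions. -/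
theorem states_re_nonpos
    (hdec : ∀ H : Submodule ℂ (Ell2 (Σ _ : ℕ, I ⊕ I)), IsLarge H → IsFinitelyDecomposable H)
    {ψ : BEll2 I →ₗ[ℂ] ℂ} (hψ : ψ ∈ states (BEll2 I)) {U : Ultrafilter I}
    (hU : ∀ E ∈ U, ψ (coordProj E) = 1) {T : BEll2 I} (hT : IsHollowContraction T) :
    (ψ T).re ≤ 0 := by
  let S : Set ℝ := {t | ∃ T : BEll2 I, IsHollowContraction T ∧ (ψ T).re = t}
  have hSbdd : BddAbove S := ⟨1, by rintro _ ⟨T, hT, rfl⟩; exact states_re_le_one hψ hT⟩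
  have hSne : S.Nonempty := ⟨_, 0, isHollowContraction_zero, rfl⟩
  have hle : ∀ T, IsHollowContraction T → (ψ T).re ≤ sSup S := fun T hT =>
    le_csSup hSbdd ⟨T, hT, rfl⟩
  refine (hle T hT).trans ?_
  by_contra! hpos
  have hseq : ∀ n : ℕ, ∃ T : BEll2 I, IsHollowContraction T ∧
      sSup S - 1 / ((n : ℝ) + 1) < (ψ T).re := by
    intro n
    obtain ⟨_, ⟨T, hT, rfl⟩, hlt⟩ := exists_lt_of_lt_csSup hSne
      (sub_lt_self (sSup S) (by positivity : 0 < 1 / ((n : ℝ) + 1)))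
    exact ⟨T, hT, hlt⟩
  choose Tn hTn hlt using hseq
  obtain ⟨δ₁, hδ₁, r₁, h₁⟩ := exists_uniform_boundedBelowOn hdec hTn
  obtain ⟨δ₂, hδ₂, r₂, h₂⟩ := exists_uniform_boundedBelowOn hdec fun n => (hTn n).neg
  obtain ⟨δ, hδ, hδ1, hδδ₁, hδδ₂⟩ : ∃ δ : ℝ, 0 < δ ∧ δ < 1 ∧ δ ≤ δ₁ ∧ δ ≤ δ₂ :=
    ⟨min (1 / 2) (min δ₁ δ₂), by positivity,
      (min_le_left _ _).trans_lt (by norm_num),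
      (min_le_right _ _).trans (min_le_left _ _), (min_le_right _ _).trans (min_le_right _ _)⟩
  have hb : 0 < 1 - δ := sub_pos.2 hδ1
  -- Compression to a set in `U` leaves `ψ (Tn n)` unchanged, and rescaling by `(1 - δ)⁻¹` stays
  -- among hollow contractions. For large `n` this contradicts `ψ (Tn n)` approaching a positive
  -- supremum.
  have key : ∀ n, (ψ (Tn n)).re ≤ (1 - δ) * sSup S := by
    intro n
    obtain ⟨E, hE, hEb⟩ := h₁ n
    obtain ⟨F, hF, hFb⟩ := h₂ n
    obtain ⟨j, hj⟩ := exists_mem_of_iUnion_eq_univ hE U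
    obtain ⟨k, hk⟩ := exists_mem_of_iUnion_eq_univ hF U
    have hweak : ∀ {Q : BEll2 I} {c : ℝ} {G G' : Set I}, BoundedBelowOn Q (c - 1) G → δ ≤ c →
        G' ⊆ G → BoundedBelowOn Q (-(1 - δ)) G' := by
      intro Q c G G' h hc hG f hf
      refine le_trans ?_ (h.mono hG f hf)
      exact mul_le_mul_of_nonneg_right (by linarith) (by positivity)
    have hc := (hTn n).compress hb (hweak (hEb j) hδδ₁ Set.inter_subset_left)
      (hweak (hFb k) hδδ₂ (Set.inter_subset_right (s := E j)))
    have hP := isStarProjection_coordProj (E j ∩ F k)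
    have hone := hU _ (inter_mem hj hk)
    have hval : ψ (coordProj (E j ∩ F k) * Tn n * coordProj (E j ∩ F k)) = ψ (Tn n) := by
      rw [(states_mul_eq_of_eq_one hψ star_mul_self_nonneg_BEll2 hP hone _).2,
        (states_mul_eq_of_eq_one hψ star_mul_self_nonneg_BEll2 hP hone _).1]
    have := hle _ hc
    rw [map_smul, hval, smul_eq_mul, Complex.re_ofReal_mul, inv_mul_le_iff₀ hb] at this
    exact this
  obtain ⟨n, hn⟩ := exists_nat_one_div_lt (mul_pos hδ hpos)
  have := key n
  have := hlt n
  linarith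

theorem states_eq_zero_of_isHollowContraction
    (hdec : ∀ H : Submodule ℂ (Ell2 (Σ _ : ℕ, I ⊕ I)), IsLarge H → IsFinitelyDecomposable H)
    {ψ : BEll2 I →ₗ[ℂ] ℂ} (hψ : ψ ∈ states (BEll2 I)) {U : Ultrafilter I}
    (hU : ∀ E ∈ U, ψ (coordProj E) = 1) {T : BEll2 I} (hT : IsHollowContraction T) :
    ψ T = 0 := by
  have h1 := states_re_nonpos hdec hψ hU hT
  have h2 := states_re_nonpos hdec hψ hU hT.neg
  rw [map_neg, Complex.neg_re] at h2
  have h3 := states_conj_symm hψ star_mul_self_nonneg_BEll2 T 1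
  rw [star_one, one_mul, mul_one, hT.isSelfAdjoint.star_eq] at h3
  apply Complex.ext
  · rw [Complex.zero_re]
    linarith
  · have := congrArg Complex.im h3
    simp only [Complex.star_def, Complex.conj_im] at this
    rw [Complex.zero_im]
    linarith

theorem isHollowContraction_smul {T : BEll2 I} (hT : IsSelfAdjoint T)
    (h : ∀ i, ⟪stdVec i, T (stdVec i)⟫_ℂ = 0) :
    IsHollowContraction ((((‖T‖ + 1)⁻¹ : ℝ) : ℂ) • T) := by
  have hpos : 0 < ‖T‖ + 1 := by positivity
  refine ⟨?_, fun i => ?_, fun x => ?_⟩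
  · rw [isSelfAdjoint_iff, star_smul, hT.star_eq, Complex.star_def, Complex.conj_ofReal]
  · rw [smul_apply, inner_smul_right, h, mul_zero]
  · rw [smul_apply, inner_smul_left, Complex.conj_ofReal, Complex.re_ofReal_mul, abs_mul,
      abs_of_pos (inv_pos.2 hpos), inv_mul_le_iff₀ hpos]
    refine (Complex.abs_re_le_norm _).trans ((norm_inner_le_norm _ _).trans ?_)
    have := T.le_opNorm x
    nlinarith [norm_nonneg x, norm_nonneg (T x)]

theorem states_eq_zero_of_diag_eq_zero
    (hdec : ∀ H : Submodule ℂ (Ell2 (Σ _ : ℕ, I ⊕ I)), IsLarge H → IsFinitelyDecomposable H)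
    {ψ : BEll2 I →ₗ[ℂ] ℂ} (hψ : ψ ∈ states (BEll2 I)) {U : Ultrafilter I}
    (hU : ∀ E ∈ U, ψ (coordProj E) = 1) {T : BEll2 I}
    (hT : ∀ i, ⟪stdVec i, T (stdVec i)⟫_ℂ = 0) : ψ T = 0 := by
  have hsa : ∀ S : BEll2 I, IsSelfAdjoint S → (∀ i, ⟪stdVec i, S (stdVec i)⟫_ℂ = 0) → ψ S = 0 := by
    intro S hS hS0
    have h := states_eq_zero_of_isHollowContraction hdec hψ hU (isHollowContraction_smul hS hS0)
    rw [map_smul, smul_eq_mul] at h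
    refine (mul_eq_zero.1 h).resolve_left ?_
    have : (‖S‖ + 1)⁻¹ ≠ 0 := by positivity
    exact_mod_cast this
  have hstar : ∀ i, ⟪stdVec i, (star T) (stdVec i)⟫_ℂ = 0 := by
    intro i
    rw [ContinuousLinearMap.star_eq_adjoint, ContinuousLinearMap.adjoint_inner_right,
      ← inner_conj_symm, hT, map_zero]
  -- `T` is half the sum of `T + star T` and `T - star T`; the first and `i` times the second are
  -- self-adjoint with zero diagonal.
  have h1 := hsa (T + star T) (IsSelfAdjoint.add_star_self T) fun i => by
    rw [add_apply, inner_add_right, hT, hstar, add_zero]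
  have h2 := hsa (Complex.I • (T - star T)) (by
    rw [isSelfAdjoint_iff, star_smul, star_sub, star_star, Complex.star_def, Complex.conj_I,
      neg_smul, ← smul_neg, neg_sub]) fun i => by
    rw [smul_apply, sub_apply, inner_smul_right, inner_sub_right, hT, hstar, sub_zero, mul_zero]
  rw [map_smul, smul_eq_mul, map_sub] at h2
  have h3 := (mul_eq_zero.1 h2).resolve_left Complex.I_ne_zero
  rw [map_add] at h1
  linear_combination (h1 + h3) / 2

/-- Finite decomposability of large subspaces yields a positive answer to Kadison–Singer. -/
theorem kadisonSinger_of_isFinitelyDecomposable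
    (hdec : ∀ H : Submodule ℂ (Ell2 (Σ _ : ℕ, ℕ ⊕ ℕ)), IsLarge H → IsFinitelyDecomposable H) :
    KadisonSinger := by
  intro φ hφ
  obtain ⟨U, hU⟩ := exists_ultrafilter_of_pureState hφ
  have hφU := tendsto_diagonal_state hφ.1 fun E hE => (hU E).1 hE
  obtain ⟨ψ, hψ, -, hlim⟩ := exists_pureState_of_ultrafilter U
  have hext : ∀ T : diagonalOperators ℕ, ψ (T : BEll2 ℕ) = φ T := fun T =>
    tendsto_nhds_unique (hlim T) (hφU T)
  -- Any extension takes at `T` the value of `φ` at the diagonal part of `T`, whence uniqueness.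
  have key : ∀ ρ : BEll2 ℕ →ₗ[ℂ] ℂ, ρ ∈ states (BEll2 ℕ) →
      (∀ T : diagonalOperators ℕ, ρ (T : BEll2 ℕ) = φ T) →
      ∀ (T : BEll2 ℕ) (D : diagonalOperators ℕ),
        (∀ i, ⟪stdVec i, (D : BEll2 ℕ) (stdVec i)⟫_ℂ = ⟪stdVec i, T (stdVec i)⟫_ℂ) →
        ρ T = φ D := by
    intro ρ hρ hρφ T D hD
    have h := states_eq_zero_of_diag_eq_zero hdec hρ (U := U)
      (fun E hE => (hρφ (diagonalProj E)).trans ((hU E).1 hE)) (T := T - D) fun i => by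
        rw [sub_apply, inner_sub_right, hD, sub_self]
    rw [map_sub, hρφ, sub_eq_zero] at h
    exact h
  refine ⟨ψ, ⟨hψ, hext⟩, fun ρ hρ => LinearMap.ext fun T => ?_⟩
  obtain ⟨D, hD⟩ := exists_diagonalPart T
  rw [key ρ hρ.1 hρ.2 T D hD, key ψ hψ hext T D hD]

end ToKadisonSinger

/-! ### Change of index set and the final equivalences. -/

section Equivalence

theorem isFinitelyDecomposable_of_embedding {I J : Type*} (e : J ↪ I)
    (h : ∀ H : Submodule ℂ (Ell2 I), IsLarge H → IsFinitelyDecomposable H)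
    (H : Submodule ℂ (Ell2 J)) (hH : IsLarge H) : IsFinitelyDecomposable H := by
  obtain ⟨A, hA⟩ := hH
  have hB : IsALarge (min A 1) H := hA.mono (lt_min hA.1 one_pos) (min_le_left _ _)
  obtain ⟨r, hr⟩ := h _ ⟨_, hB.comap_restrictL e (min_le_right _ _)⟩
  exact ⟨r, hr.of_comap_restrictL e hA.2.1⟩

theorem kadisonSinger_of_infinite {I : Type*} [Infinite I]
    (h : ∀ H : Submodule ℂ (Ell2 I), IsLarge H → IsFinitelyDecomposable H) : KadisonSinger := by
  obtain ⟨e⟩ := nonempty_embedding_nat (Σ _ : ℕ, ℕ ⊕ ℕ)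
  exact kadisonSinger_of_isFinitelyDecomposable
    (isFinitelyDecomposable_of_embedding (e.trans (Infinite.natEmbedding I)) h)

theorem isFinitelyDecomposable_of_uniform {I : Type*}
    (h : ∀ A : ℝ, 0 < A → A < 1 → ∃ r : ℕ,
      ∀ H : Submodule ℂ (Ell2 I), IsALarge A H → IsRDecomposable r H)
    (H : Submodule ℂ (Ell2 I)) (hH : IsLarge H) : IsFinitelyDecomposable H := by
  obtain ⟨A, hA⟩ := hH
  have hpos : 0 < min A (1 / 2) := lt_min hA.1 (by norm_num)
  obtain ⟨r, hr⟩ := h _ hpos ((min_le_right _ _).trans_lt (by norm_num))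
  exact ⟨r, hr H (hA.mono hpos (min_le_left _ _))⟩

end Equivalence

end KadisonSinger

theorem mainTheorem11 :
    (∀ (I : Type u) [Infinite I],
      [KadisonSinger,
        ∀ H : Submodule ℂ (Ell2 I), IsLarge H → IsFinitelyDecomposable H,
        ∀ A : ℝ, 0 < A → A < 1 → ∃ r : ℕ,
          ∀ H : Submodule ℂ (Ell2 I), IsALarge A H → IsRDecomposable r H].TFAE) ∧
    [KadisonSinger,
      ∀ (I : Type u) (H : Submodule ℂ (Ell2 I)), IsLarge H → IsFinitelyDecomposable H,
      ∀ A : ℝ, 0 < A → A < 1 → ∃ r : ℕ,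
        ∀ (I : Type u) (H : Submodule ℂ (Ell2 I)), IsALarge A H → IsRDecomposable r H].TFAE := by
  refine ⟨fun I _ => ?_, ?_⟩
  · tfae_have 1 → 3 := fun hKS A hA hA1 =>
      (hKS.exists_isRDecomposable hA hA1).imp fun r hr => hr I
    tfae_have 3 → 2 := isFinitelyDecomposable_of_uniform
    tfae_have 2 → 1 := kadisonSinger_of_infinite
    tfae_finish
  · tfae_have 1 → 3 := fun hKS A hA hA1 => hKS.exists_isRDecomposable hA hA1
    tfae_have 3 → 2 := fun h I => isFinitelyDecomposable_of_uniform fun A hA hA1 =>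
      (h A hA hA1).imp fun r hr => hr I
    -- One infinite index set in the given universe suffices.
    tfae_have 2 → 1 := fun h => kadisonSinger_of_infinite (h (ULift ℕ))
    tfae_finish
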